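/- For a function list $\{g_1,g_2\}$ of holomorphic functions near $\xi\in\mathbb C^2$ having $\xi$ as an isolated common zero, and $h$ holomorphic near $\xi$, the local residue is $$\operatorname{Res}_{\{g_1,g_2\},\xi}\Big(\frac{h\,dz_1\wedge dz_2}{g_1g_2}\Big)=\Big(\frac1{2\pi i}\Big)^2\oint_{\Gamma}\frac{h\,dz_1\wedge dz_2}{g_1g_2},\qquad \Gamma=\{z\in U:\ |g_1(z)|=\varepsilon_1,\ |g_2(z)|=\varepsilon_2\},$$ where $U$ is a ball about $\xi$ such that $g_1,g_2,h$ are holomorphic in a neighborhood of $\overline U$ and $\xi$ is the only common zero of $g_1,g_2$ in $U$; where $\varepsilon_1,\varepsilon_2>0$ are so small that $\{z\in\overline U: |g_i(z)|\le\varepsilon_i,\ i=1,2\}\subset U$, and such that the Jacobian determinant of $(g_1,g_2)$ vanishes nowhere on $\Gamma$; and where $\Gamma$ is oriented by $d(\arg g_1)\wedge d(\arg g_2)$. (The value does not depend on the choice of $U,\varepsilon_1,\varepsilon_2$.) **Lemma.** Let $f_1,f_2,f_3\in\mathbb C[z_1,z_2]$ be three linear functions (polynomials of degree at most $1$) vanishing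 at a point $\xi\in\mathbb C^2$, such that the ideals $\langle f_1,f_2\rangle$, $\langle f_2,f_3\rangle$ and $\langle f_3,f_1\rangle$ of $\mathbb C[z_1,z_2]$ are all zero-dimensional. Let $h$ be a holomorphic function in a neighborhood of $\xi$ and $\omega=h\,dz_1\wedge dz_2/(f_1f_2f_3)$. Then the local residues of $\omega$ at $\xi$ regarding the function lists $\{f_1f_2,f_3\}$, $\{f_2f_3,f_1\}$ and $\{f_3f_1,f_2\}$ are well defined (that is, contours as above exist and all of them give the same value), and $$\operatorname{Res}_{\{f_1f_2,f_3\},\xi}(\omega)+\operatorname{Res}_{\{f_2f_3,f_1\},\xi}(\omega)+\operatorname{Res}_{\{f_3f_1,f_2\},\xi}(\omega)=0 .$$ -/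

import Mathlib

open MeasureTheory Metric

noncomputable section

namespace LocalResidue

variable {n : ℕ}

/-- The polynomial function on `ℂⁿ` (with its Euclidean norm) given by a polynomial. -/
def polyFun (p : MvPolynomial (Fin n) ℂ) : EuclideanSpace ℂ (Fin n) → ℂ :=
  fun z => MvPolynomial.eval (fun i => z i) p

/-- The Jacobian determinant `det (∂ fᵢ / ∂ zⱼ)` at `z`. -/
def jacobian (f : Fin n → EuclideanSpace ℂ (Fin n) → ℂ) (z : EuclideanSpace ℂ (Fin n)) : ℂ :=
  (Matrix.of fun i j : Fin n => fderiv ℂ (f i) z (EuclideanSpace.single j 1)).det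

/-- The set `Γ = {z ∈ U : |fᵢ(z)| = εᵢ for all i}`, where `U` is the ball of radius `ρ`
about `ξ`. -/
def cycle (f : Fin n → EuclideanSpace ℂ (Fin n) → ℂ) (ξ : EuclideanSpace ℂ (Fin n))
    (ρ : ℝ) (ε : Fin n → ℝ) : Set (EuclideanSpace ℂ (Fin n)) :=
  {z | z ∈ ball ξ ρ ∧ ∀ i, ‖f i z‖ = ε i}

/-- The conditions on the ball `U = ball ξ ρ` and on the levels `εᵢ` under which the contour
`Γ` may be used to compute the residue at `ξ` of `h dz₁ ∧ ⋯ ∧ dzₙ / (f₁ ⋯ fₙ)`. -/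
structure IsAdmissible (f : Fin n → EuclideanSpace ℂ (Fin n) → ℂ)
    (h : EuclideanSpace ℂ (Fin n) → ℂ) (ξ : EuclideanSpace ℂ (Fin n))
    (ρ : ℝ) (ε : Fin n → ℝ) : Prop where
  rho_pos : 0 < ρ
  eps_pos : ∀ i, 0 < ε i
  /-- The functions are holomorphic in a neighborhood of the closure of `U`. -/
  holomorphic : ∃ W : Set (EuclideanSpace ℂ (Fin n)), IsOpen W ∧ closedBall ξ ρ ⊆ W ∧
    (∀ i, DifferentiableOn ℂ (f i) W) ∧ DifferentiableOn ℂ h W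
  /-- `ξ` is the only common zero in `U`. -/
  isolated : ∀ z ∈ ball ξ ρ, (∀ i, f i z = 0) ↔ z = ξ
  /-- The levels are so small that `{|fᵢ| ≤ εᵢ}` does not reach the boundary of `U`
  (in particular `Γ` is compact). -/
  small : ∀ z ∈ closedBall ξ ρ, (∀ i, ‖f i z‖ ≤ ε i) → z ∈ ball ξ ρ
  /-- The levels are regular: `Γ` is a smooth real `n`-dimensional submanifold on which the
  form `d(arg f₁) ∧ ⋯ ∧ d(arg fₙ)` vanishes nowhere. -/
  regular : ∀ z ∈ cycle f ξ ρ ε, jacobian f z ≠ 0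

/-- The coefficient of the pull-back of `dz₁ ∧ ⋯ ∧ dzₙ` along `φ : ℝⁿ → ℂⁿ`,
that is `det (∂ φᵢ / ∂ xⱼ)`. -/
def pullbackDz (φ : (Fin n → ℝ) → EuclideanSpace ℂ (Fin n)) (x : Fin n → ℝ) : ℂ :=
  (Matrix.of fun i j : Fin n => (fderiv ℝ φ x (Pi.single j 1)) i).det

/-- The coefficient of the pull-back of `d(arg f₁) ∧ ⋯ ∧ d(arg fₙ)` along `φ : ℝⁿ → ℂⁿ`,
where `d(arg g) = Im (dg / g)` for every nonvanishing `g`. -/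
def pullbackDarg (f : Fin n → EuclideanSpace ℂ (Fin n) → ℂ)
    (φ : (Fin n → ℝ) → EuclideanSpace ℂ (Fin n)) (x : Fin n → ℝ) : ℝ :=
  (Matrix.of fun i j : Fin n =>
    (fderiv ℝ (fun y => f i (φ y)) x (Pi.single j 1) / f i (φ x)).im).det

/-- A positively oriented parametrization, up to a null set, of the set `Γ` with the
orientation given by `d(arg f₁) ∧ ⋯ ∧ d(arg fₙ)`: finitely many injective, orientation
preserving `C¹` maps from open subsets of `ℝⁿ` to `Γ`, with disjoint images that together
cover `Γ` up to a set of `n`-dimensional Hausdorff measure zero. -/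
structure Parametrization (f : Fin n → EuclideanSpace ℂ (Fin n) → ℂ)
    (Γ : Set (EuclideanSpace ℂ (Fin n))) where
  /-- number of pieces -/
  N : ℕ
  /-- the parameter domains -/
  V : Fin N → Set (Fin n → ℝ)
  /-- the parametrizing maps -/
  φ : Fin N → (Fin n → ℝ) → EuclideanSpace ℂ (Fin n)
  isOpen : ∀ k, IsOpen (V k)
  contDiffOn : ∀ k, ContDiffOn ℝ 1 (φ k) (V k)
  injOn : ∀ k, Set.InjOn (φ k) (V k)
  mapsTo : ∀ k, Set.MapsTo (φ k) (V k) Γ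
  oriented : ∀ k, ∀ x ∈ V k, 0 < pullbackDarg f (φ k) x
  disjoint : ∀ k l, k ≠ l → Disjoint (φ k '' V k) (φ l '' V l)
  covers : Measure.hausdorffMeasure (n : ℝ) (Γ \ ⋃ k, φ k '' V k) = 0

/-- The integral `∮_Γ h dz₁ ∧ ⋯ ∧ dzₙ / (f₁ ⋯ fₙ)`, computed in a parametrization of `Γ`. -/
def Parametrization.integral {f : Fin n → EuclideanSpace ℂ (Fin n) → ℂ}
    {Γ : Set (EuclideanSpace ℂ (Fin n))} (P : Parametrization f Γ)
    (h : EuclideanSpace ℂ (Fin n) → ℂ) : ℂ :=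
  ∑ k, ∫ x in P.V k, h (P.φ k x) / (∏ i, f i (P.φ k x)) * pullbackDz (P.φ k) x

/-- `HasLocalResidue f h ξ r` says that the local residue at `ξ`, regarding the function list
`{f₁, …, fₙ}`, of the form `h dz₁ ∧ ⋯ ∧ dzₙ / (f₁ ⋯ fₙ)` is well defined and equal to `r`:
`(2πi)⁻ⁿ ∮_Γ h dz₁ ∧ ⋯ ∧ dzₙ / (f₁ ⋯ fₙ) = r` for every admissible contour `Γ` and every
positively oriented parametrization of `Γ`, and these do exist. -/
structure HasLocalResidue (f : Fin n → EuclideanSpace ℂ (Fin n) → ℂ)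
    (h : EuclideanSpace ℂ (Fin n) → ℂ) (ξ : EuclideanSpace ℂ (Fin n)) (r : ℂ) : Prop where
  exists_contour : ∃ (ρ : ℝ) (ε : Fin n → ℝ), IsAdmissible f h ξ ρ ε ∧
    Nonempty (Parametrization f (cycle f ξ ρ ε))
  eq_integral : ∀ (ρ : ℝ) (ε : Fin n → ℝ), IsAdmissible f h ξ ρ ε →
    ∀ P : Parametrization f (cycle f ξ ρ ε),
      (1 / (2 * (Real.pi : ℂ) * Complex.I)) ^ n * P.integral h = r

/-- The local residue is unique. -/
theorem HasLocalResidue.unique {f : Fin n → EuclideanSpace ℂ (Fin n) → ℂ}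
    {h : EuclideanSpace ℂ (Fin n) → ℂ} {ξ : EuclideanSpace ℂ (Fin n)} {r s : ℂ}
    (hr : HasLocalResidue f h ξ r) (hs : HasLocalResidue f h ξ s) : r = s := by
  obtain ⟨ρ, ε, hA, ⟨P⟩⟩ := hr.exists_contour
  rw [← hr.eq_integral ρ ε hA P, ← hs.eq_integral ρ ε hA P]

end LocalResidue

end

/-! By linearity and the vanishing at ξ, each fᵢ is a linear form lᵢ in z - ξ, and
zero-dimensionality makes the forms pairwise independent. If e₁, e₂ is the basis dual to l₁, l₃, the
residue for {l₁l₂, l₃} is dh_ξ(e₁) / (l₂(e₁) det(l₁, l₃)), where e₁ spans the kernel of l₃. In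
coefficients, with vᵢ = (Bᵢ, -Aᵢ) and dᵢⱼ = AᵢBⱼ - BᵢAⱼ, the three residues add up to -dh_ξ(d₁₂v₃ +
d₂₃v₁ + d₃₁v₂) / (d₁₂d₂₃d₃₁), which is zero by Cramer's identity.

The residue must be computed on every admissible contour and in every parametrization. On Γ the form
h dz₁∧dz₂ / (f₁f₂) equals i² (h / J) d(arg f₁)∧d(arg f₂), with J the Jacobian
(`Parametrization.integral_eq`). The area formula turns its integral into a sum over the two sheets
of Γ above a torus, independent of the parametrization (`Parametrization.sum_integral_eq`). The
sheets need only be measurable, so monodromy of the square root does no harm.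

The contour is invariant under z ↦ ξ + exp(iα)(z - ξ), and J is homogeneous of degree 1. Averaging
over α therefore replaces h by its differential at ξ, by Cauchy's formula
(`intervalIntegral_scale_div_jacobian`). The sum of dh_ξ(z - ξ) / J(z) over the two sheets is then
constant (`sum_fderiv_div_jacobian`), which gives the value in `integral_lineList`.

Existence of a contour comes from levels (κt², t) with κ fixed so that the discriminant has an
explicit smooth square root, and t small (`exists_isAdmissible`, `nonempty_parametrization`). -/

noncomputable section

namespace LocalResidue

/-! ### Arguments of complex numbers in a half plane. -/

section General

/-- The half-open right half plane: exactly one of `z`, `-z` belongs to it when `z ≠ 0`. -/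
def halfPlane : Set ℂ := {z | 0 < z.re ∨ (z.re = 0 ∧ z.im < 0)}

lemma measurableSet_halfPlane : MeasurableSet halfPlane :=
  (measurableSet_lt measurable_const Complex.measurable_re).union
    ((measurableSet_eq_fun Complex.measurable_re measurable_const).inter
      (measurableSet_lt Complex.measurable_im measurable_const))

lemma re_nonneg_of_mem_halfPlane {z : ℂ} (hz : z ∈ halfPlane) : 0 ≤ z.re := by
  rcases hz with h | h
  · exact h.le
  · exact h.1.ge

lemma mem_slitPlane_of_mem_halfPlane {z : ℂ} (hz : z ∈ halfPlane) : z ∈ Complex.slitPlane := by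
  rcases hz with h | h
  · exact Or.inl h
  · exact Or.inr h.2.ne

lemma exists_unit_mul_mem_halfPlane {z : ℂ} (hz : z ≠ 0) :
    ∃ δ : ℤˣ, ((δ : ℤ) : ℂ) * z ∈ halfPlane := by
  have h0 : z.re ≠ 0 ∨ z.im ≠ 0 := by
    by_contra! h
    exact hz (Complex.ext h.1 h.2)
  rcases lt_trichotomy z.re 0 with h | h | h
  · exact ⟨-1, Or.inl (by simpa using h)⟩
  · rcases lt_trichotomy z.im 0 with h' | h' | h'
    · exact ⟨1, Or.inr (by simpa using ⟨h, h'⟩)⟩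
    · simp_all
    · exact ⟨-1, Or.inr (by simpa using ⟨h, h'⟩)⟩
  · exact ⟨1, Or.inl (by simpa using h)⟩

lemma unit_eq_of_mul_mem_halfPlane {z : ℂ} {δ δ' : ℤˣ} (h : ((δ : ℤ) : ℂ) * z ∈ halfPlane)
    (h' : ((δ' : ℤ) : ℂ) * z ∈ halfPlane) : δ = δ' := by
  rcases Int.units_eq_one_or δ with rfl | rfl <;> rcases Int.units_eq_one_or δ' with rfl | rfl
  · rfl
  · simp only [halfPlane, Set.mem_ofPred_eq] at h h'
    simp at h h'
    grind
  · simp only [halfPlane, Set.mem_ofPred_eq] at h h'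
    simp at h h'
    grind
  · rfl

lemma exp_mem_halfPlane {θ : ℝ} (hθ : θ ∈ Set.Ico (-(Real.pi / 2)) (Real.pi / 2)) :
    Complex.exp (Complex.I * θ) ∈ halfPlane := by
  have hre : (Complex.exp (Complex.I * θ)).re = Real.cos θ := by
    rw [mul_comm, Complex.exp_ofReal_mul_I_re]
  have him : (Complex.exp (Complex.I * θ)).im = Real.sin θ := by
    rw [mul_comm, Complex.exp_ofReal_mul_I_im]
  rcases hθ.1.eq_or_lt with h | h
  · right
    rw [hre, him, ← h]
    simp
  · left
    rw [hre]
    exact Real.cos_pos_of_mem_Ioo ⟨h, hθ.2⟩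

lemma pos_mul_mem_halfPlane {z : ℂ} {r : ℝ} (hr : 0 < r) (hz : z ∈ halfPlane) :
    (r : ℂ) * z ∈ halfPlane := by
  rcases hz with h | h
  · left; simpa using mul_pos hr h
  · right
    simp only [Complex.re_ofReal_mul, Complex.im_ofReal_mul]
    exact ⟨by simp [h.1], mul_neg_of_pos_of_neg hr h.2⟩

lemma arg_mem_Ico_of_mem_halfPlane {z : ℂ} (hz : z ∈ halfPlane) :
    z.arg ∈ Set.Ico (-(Real.pi / 2)) (Real.pi / 2) := by
  have h := abs_le.1 (Complex.abs_arg_le_pi_div_two_iff.2 (re_nonneg_of_mem_halfPlane hz))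
  refine ⟨h.1, lt_of_le_of_ne h.2 fun h2 => ?_⟩
  have := Complex.arg_eq_pi_div_two_iff.1 h2
  rcases hz with hz | hz
  · exact hz.ne' this.1
  · exact lt_asymm hz.2 this.2

/-- Arc against chord: the chord is 2|sin((a - b)/2)|, and Jordan's inequality bounds the sine below
as long as the half difference is at most π/2. -/
lemma abs_sub_le_norm_exp_sub {a b : ℝ} (hab : |a - b| ≤ Real.pi) :
    |a - b| ≤ Real.pi / 2 * ‖Complex.exp (Complex.I * a) - Complex.exp (Complex.I * b)‖ := by
  have h1 : Complex.exp (Complex.I * a) - Complex.exp (Complex.I * b)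
      = Complex.exp (Complex.I * b) * (Complex.exp (Complex.I * ((a - b : ℝ) : ℂ)) - 1) := by
    rw [mul_sub, ← Complex.exp_add]
    push_cast
    ring_nf
  rw [h1, norm_mul, Complex.norm_exp_I_mul_ofReal, one_mul, Complex.norm_exp_I_mul_ofReal_sub_one,
    norm_mul, Real.norm_eq_abs, Real.norm_eq_abs, abs_two]
  have h2 : |(a - b) / 2| ≤ Real.pi / 2 := by
    rw [abs_div, abs_two]; linarith
  have h3 := Real.mul_abs_le_abs_sin h2
  rw [abs_div, abs_two] at h3
  have hpi := Real.pi_pos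
  calc |a - b| = Real.pi * (2 / Real.pi * (|a - b| / 2)) := by field_simp
    _ ≤ Real.pi * |Real.sin ((a - b) / 2)| := by gcongr
    _ = _ := by ring

lemma eq_norm_mul_exp_arg (z : ℂ) : z = (‖z‖ : ℂ) * Complex.exp (Complex.I * z.arg) := by
  conv_lhs => rw [← Complex.norm_mul_exp_arg_mul_I z]
  rw [mul_comm Complex.I]

/-- In the closed right half plane two arguments differ by at most π, so there is no branch jump.
This Lipschitz bound is the reason for cutting each circle into two half circles, selected by a
sign, instead of using the argument on the whole circle. -/
lemma abs_arg_sub_arg_le {z w : ℂ} {r : ℝ} (hr : 0 < r) (hz : ‖z‖ = r) (hw : ‖w‖ = r)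
    (hz0 : 0 ≤ z.re) (hw0 : 0 ≤ w.re) :
    |z.arg - w.arg| ≤ Real.pi / 2 / r * ‖z - w‖ := by
  have h1 := abs_le.1 (Complex.abs_arg_le_pi_div_two_iff.2 hz0)
  have h2 := abs_le.1 (Complex.abs_arg_le_pi_div_two_iff.2 hw0)
  refine (abs_sub_le_norm_exp_sub (abs_le.2 ⟨by linarith, by linarith⟩)).trans_eq ?_
  conv_rhs => rw [eq_norm_mul_exp_arg z, eq_norm_mul_exp_arg w, hz, hw, ← mul_sub, norm_mul]
  rw [Complex.norm_real, Real.norm_of_nonneg hr.le]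
  field_simp

/-! ### Sheets over a torus, their patches and angle charts. -/

variable {n : ℕ}

/-- The box `[-π/2, π/2)ⁿ` of angles. -/
def angleBox (n : ℕ) : Set (Fin n → ℝ) :=
  Set.univ.pi fun _ => Set.Ico (-(Real.pi / 2)) (Real.pi / 2)

/-- The point of the torus `|wⱼ| = εⱼ` with angles `θⱼ` relative to the signs `δⱼ`. -/
def torusPoint (ε : Fin n → ℝ) (δ : Fin n → ℤˣ) (θ : Fin n → ℝ) : Fin n → ℂ :=
  fun j => ((δ j : ℤ) : ℂ) * (ε j * Complex.exp (Complex.I * θ j))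

lemma unit_mul_self (δ : ℤˣ) : ((δ : ℤ) : ℂ) * ((δ : ℤ) : ℂ) = 1 := by
  rcases Int.units_eq_one_or δ with rfl | rfl <;> simp

lemma norm_unit (δ : ℤˣ) : ‖((δ : ℤ) : ℂ)‖ = 1 := by
  rcases Int.units_eq_one_or δ with rfl | rfl <;> simp

lemma unit_ne_zero (δ : ℤˣ) : ((δ : ℤ) : ℂ) ≠ 0 := by
  rcases Int.units_eq_one_or δ with rfl | rfl <;> simp

lemma norm_torusPoint {ε : Fin n → ℝ} (hε : ∀ j, 0 < ε j) (δ : Fin n → ℤˣ) (θ : Fin n → ℝ)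
    (j : Fin n) : ‖torusPoint ε δ θ j‖ = ε j := by
  rw [torusPoint, norm_mul, norm_unit, norm_mul, Complex.norm_exp_I_mul_ofReal, Complex.norm_real,
    Real.norm_of_nonneg (hε j).le, one_mul, mul_one]

lemma continuous_torusPoint (ε : Fin n → ℝ) (δ : Fin n → ℤˣ) : Continuous (torusPoint ε δ) := by
  unfold torusPoint
  fun_prop

/-- A decomposition of `Γ` into finitely many measurable sections of `(f₁, …, fₙ)` over the torus
`|wⱼ| = εⱼ`. -/
structure Sheets (f : Fin n → EuclideanSpace ℂ (Fin n) → ℂ)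
    (Γ : Set (EuclideanSpace ℂ (Fin n))) (ε : Fin n → ℝ) (ι : Type) where
  /-- the sections -/
  sec : ι → (Fin n → ℂ) → EuclideanSpace ℂ (Fin n)
  measurable_sec : ∀ i, Measurable (sec i)
  sec_mem : ∀ i w, (∀ j, ‖w j‖ = ε j) → sec i w ∈ Γ
  apply_sec : ∀ i w, (∀ j, ‖w j‖ = ε j) → ∀ j, f j (sec i w) = w j
  exists_sec : ∀ z ∈ Γ, ∃ i, sec i (fun j => f j z) = z
  sec_ne : ∀ w, (∀ j, ‖w j‖ = ε j) → ∀ i i', i ≠ i' → sec i w ≠ sec i' w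

section Area

variable {f : Fin n → EuclideanSpace ℂ (Fin n) → ℂ} {Γ : Set (EuclideanSpace ℂ (Fin n))}
  {ε : Fin n → ℝ} {ι : Type}

/-- The part of `Γ` lying on the sheet `i` over the orthant of the torus given by `δ`. -/
def Sheets.patch (S : Sheets f Γ ε ι) (c : ι × (Fin n → ℤˣ)) : Set (EuclideanSpace ℂ (Fin n)) :=
  {z | (∀ j, ((c.2 j : ℤ) : ℂ) * f j z ∈ halfPlane) ∧ S.sec c.1 (fun j => f j z) = z}

/-- The parametrization of a patch by angles. -/
def Sheets.chart (S : Sheets f Γ ε ι) (c : ι × (Fin n → ℤˣ)) (θ : Fin n → ℝ) :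
    EuclideanSpace ℂ (Fin n) :=
  S.sec c.1 (torusPoint ε c.2 θ)

/-- The angles of a point relative to signs. -/
def angle (f : Fin n → EuclideanSpace ℂ (Fin n) → ℂ) (δ : Fin n → ℤˣ)
    (z : EuclideanSpace ℂ (Fin n)) : Fin n → ℝ :=
  fun j => (((δ j : ℤ) : ℂ) * f j z).arg

lemma Sheets.measurableSet_patch (S : Sheets f Γ ε ι) (hf : ∀ j, Continuous (f j))
    (c : ι × (Fin n → ℤˣ)) : MeasurableSet (S.patch c) := by
  have h1 : MeasurableSet {z | ∀ j, ((c.2 j : ℤ) : ℂ) * f j z ∈ halfPlane} := by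
    rw [Set.ofPred_forall]
    exact MeasurableSet.iInter fun j =>
      (measurable_const.mul (hf j).measurable) measurableSet_halfPlane
  exact h1.inter (measurableSet_eq_fun
    ((S.measurable_sec c.1).comp (measurable_pi_lambda _ fun j => (hf j).measurable)) measurable_id)

lemma Sheets.measurable_chart (S : Sheets f Γ ε ι) (c : ι × (Fin n → ℤˣ)) :
    Measurable (S.chart c) :=
  (S.measurable_sec c.1).comp (continuous_torusPoint ε c.2).measurable

lemma Sheets.chart_mem (S : Sheets f Γ ε ι) (hε : ∀ j, 0 < ε j) (c : ι × (Fin n → ℤˣ))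
    (θ : Fin n → ℝ) : S.chart c θ ∈ Γ :=
  S.sec_mem _ _ (norm_torusPoint hε _ _)

lemma Sheets.apply_chart (S : Sheets f Γ ε ι) (hε : ∀ j, 0 < ε j) (c : ι × (Fin n → ℤˣ))
    (θ : Fin n → ℝ) (j : Fin n) : f j (S.chart c θ) = torusPoint ε c.2 θ j :=
  S.apply_sec _ _ (norm_torusPoint hε _ _) j

lemma Sheets.chart_mem_patch (S : Sheets f Γ ε ι) (hε : ∀ j, 0 < ε j) (c : ι × (Fin n → ℤˣ))
    {θ : Fin n → ℝ} (hθ : θ ∈ angleBox n) : S.chart c θ ∈ S.patch c := by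
  refine ⟨fun j => ?_, ?_⟩
  · rw [S.apply_chart hε, torusPoint, ← mul_assoc, unit_mul_self, one_mul]
    exact pos_mul_mem_halfPlane (hε j) (exp_mem_halfPlane (hθ j trivial))
  · simp only [S.apply_chart hε]
    rfl

lemma Sheets.angle_chart (S : Sheets f Γ ε ι) (hε : ∀ j, 0 < ε j) (c : ι × (Fin n → ℤˣ))
    {θ : Fin n → ℝ} (hθ : θ ∈ angleBox n) : angle f c.2 (S.chart c θ) = θ := by
  ext j
  have h := hθ j trivial
  rw [angle, S.apply_chart hε, torusPoint, ← mul_assoc, unit_mul_self, one_mul,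
    Complex.arg_real_mul _ (hε j), mul_comm, Complex.arg_exp_mul_I, toIocMod_eq_self]
  constructor <;> linarith [h.1, h.2, Real.pi_pos]

lemma Sheets.angle_mem (S : Sheets f Γ ε ι) {c : ι × (Fin n → ℤˣ)}
    {z : EuclideanSpace ℂ (Fin n)} (hz : z ∈ S.patch c) : angle f c.2 z ∈ angleBox n :=
  fun j _ => arg_mem_Ico_of_mem_halfPlane (hz.1 j)

lemma Sheets.chart_angle (S : Sheets f Γ ε ι) {c : ι × (Fin n → ℤˣ)}
    {z : EuclideanSpace ℂ (Fin n)} (hz : z ∈ S.patch c) (hzε : ∀ j, ‖f j z‖ = ε j) :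
    S.chart c (angle f c.2 z) = z := by
  rw [Sheets.chart]
  convert hz.2 using 2
  ext j
  have h := eq_norm_mul_exp_arg (((c.2 j : ℤ) : ℂ) * f j z)
  rw [norm_mul, norm_unit, one_mul, hzε] at h
  rw [torusPoint, angle, ← h, ← mul_assoc, unit_mul_self, one_mul]

lemma Sheets.exists_patch (S : Sheets f Γ ε ι) (hε : ∀ j, 0 < ε j)
    (hΓ : ∀ z ∈ Γ, ∀ j, ‖f j z‖ = ε j) {z : EuclideanSpace ℂ (Fin n)} (hz : z ∈ Γ) :
    ∃ c, z ∈ S.patch c := by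
  obtain ⟨i, hi⟩ := S.exists_sec z hz
  have h0 : ∀ j, f j z ≠ 0 := fun j h => by
    have := hΓ z hz j
    rw [h, norm_zero] at this
    exact (hε j).ne this
  choose δ hδ using fun j => exists_unit_mul_mem_halfPlane (h0 j)
  exact ⟨(i, δ), hδ, hi⟩

lemma Sheets.patch_unique (S : Sheets f Γ ε ι) {z : EuclideanSpace ℂ (Fin n)}
    (hzε : ∀ j, ‖f j z‖ = ε j) {c c' : ι × (Fin n → ℤˣ)} (hc : z ∈ S.patch c)
    (hc' : z ∈ S.patch c') : c = c' := by
  refine Prod.ext ?_ (funext fun j => unit_eq_of_mul_mem_halfPlane (hc.1 j) (hc'.1 j))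
  by_contra h
  exact S.sec_ne _ hzε _ _ h (hc.2.trans hc'.2.symm)

/-- Lipschitz maps send sets of zero n-dimensional Hausdorff measure to null sets. Hence the part of
Γ missed by a parametrization is negligible in angle coordinates. -/
lemma Sheets.lipschitzOnWith_angle (S : Sheets f Γ ε ι) (hε : ∀ j, 0 < ε j)
    (hΓ : ∀ z ∈ Γ, ∀ j, ‖f j z‖ = ε j) {K : NNReal} (hK : ∀ j, LipschitzOnWith K (f j) Γ)
    (c : ι × (Fin n → ℤˣ)) : ∃ K', LipschitzOnWith K' (angle f c.2) (Γ ∩ S.patch c) := by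
  have hpi := Real.pi_pos
  refine ⟨Real.toNNReal (∑ j, Real.pi / 2 / ε j * K), LipschitzOnWith.of_dist_le_mul
    fun x hx y hy => ?_⟩
  have hnn : ∀ j, 0 ≤ Real.pi / 2 / ε j * K := fun j => by have := hε j; positivity
  rw [Real.coe_toNNReal _ (Finset.sum_nonneg fun j _ => hnn j)]
  refine (dist_pi_le_iff (by have := Finset.sum_nonneg fun j (_ : j ∈ Finset.univ) => hnn j
                             positivity)).2 fun j => ?_
  have h1 := abs_arg_sub_arg_le (hε j) (z := ((c.2 j : ℤ) : ℂ) * f j x)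
    (w := ((c.2 j : ℤ) : ℂ) * f j y)
    (by rw [norm_mul, norm_unit, one_mul, hΓ x hx.1]) (by rw [norm_mul, norm_unit, one_mul, hΓ y hy.1])
    (re_nonneg_of_mem_halfPlane (hx.2.1 j)) (re_nonneg_of_mem_halfPlane (hy.2.1 j))
  rw [← mul_sub, norm_mul, norm_unit, one_mul, ← dist_eq_norm] at h1
  have h2 := (hK j).dist_le_mul x hx.1 y hy.1
  have h3 : 0 ≤ Real.pi / 2 / ε j := by have := hε j; positivity
  calc dist (angle f c.2 x j) (angle f c.2 y j) ≤ Real.pi / 2 / ε j * (K * dist x y) :=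
        h1.trans (by gcongr)
    _ = Real.pi / 2 / ε j * K * dist x y := by ring
    _ ≤ _ := by
      gcongr
      exact Finset.single_le_sum (fun j _ => hnn j) (Finset.mem_univ j)

end Area

/-! ### The area formula: integrals against the arguments do not depend on the parametrization. -/

section Area

variable {f : Fin n → EuclideanSpace ℂ (Fin n) → ℂ} {Γ : Set (EuclideanSpace ℂ (Fin n))}
  {ε : Fin n → ℝ} {ι : Type}

/-- The pull-back of the forms `d(arg fⱼ)` as a linear map. -/
def dangle (f : Fin n → EuclideanSpace ℂ (Fin n) → ℂ)
    (φ : (Fin n → ℝ) → EuclideanSpace ℂ (Fin n)) (x : Fin n → ℝ) :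
    (Fin n → ℝ) →L[ℝ] (Fin n → ℝ) :=
  ContinuousLinearMap.pi fun j =>
    Complex.imCLM ∘L ((f j (φ x))⁻¹ • fderiv ℝ (fun y => f j (φ y)) x)

lemma det_dangle (f : Fin n → EuclideanSpace ℂ (Fin n) → ℂ)
    (φ : (Fin n → ℝ) → EuclideanSpace ℂ (Fin n)) (x : Fin n → ℝ) :
    (dangle f φ x).det = pullbackDarg f φ x := by
  rw [ContinuousLinearMap.det, ← LinearMap.det_toMatrix', pullbackDarg]
  congr 1
  ext i j
  simp only [LinearMap.toMatrix'_apply, dangle, Matrix.of_apply]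
  rw [div_eq_inv_mul]
  simp

/-- The angle is the imaginary part of a logarithm, smooth on the slit plane, and the constant sign
cancels in the logarithmic derivative. -/
lemma hasFDerivAt_angle {φ : (Fin n → ℝ) → EuclideanSpace ℂ (Fin n)} {x : Fin n → ℝ}
    (hf : ∀ j, Differentiable ℂ (f j)) (hφ : DifferentiableAt ℝ φ x) {δ : Fin n → ℤˣ}
    (hδ : ∀ j, ((δ j : ℤ) : ℂ) * f j (φ x) ∈ halfPlane) :
    HasFDerivAt (fun y => angle f δ (φ y)) (dangle f φ x) x := by
  refine hasFDerivAt_pi.2 fun j => ?_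
  have h1 : HasFDerivAt (fun y => f j (φ y)) (fderiv ℝ (fun y => f j (φ y)) x) x :=
    DifferentiableAt.hasFDerivAt
      (((hf j (φ x)).restrictScalars ℝ).comp x hφ)
  have h2 := h1.const_mul ((δ j : ℤ) : ℂ)
  have h3 : HasFDerivAt Complex.log (ContinuousLinearMap.restrictScalars ℝ
      (ContinuousLinearMap.toSpanSingleton ℂ (((δ j : ℤ) : ℂ) * f j (φ x))⁻¹))
      (((δ j : ℤ) : ℂ) * f j (φ x)) :=
    (Complex.hasStrictDerivAt_log
      (mem_slitPlane_of_mem_halfPlane (hδ j))).hasDerivAt.hasFDerivAt.restrictScalars ℝ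
  have h4 := (Complex.imCLM.hasFDerivAt).comp x (h3.comp x h2)
  have h5 : (fun y => angle f δ (φ y) j) = Complex.imCLM ∘ Complex.log ∘
      fun y => ((δ j : ℤ) : ℂ) * f j (φ y) := by
    ext y
    simp [angle, Complex.log_im]
  rw [h5]
  refine h4.congr_fderiv ?_
  ext v
  simp only [ContinuousLinearMap.comp_apply, smul_apply, ContinuousLinearMap.coe_restrictScalars',
    ContinuousLinearMap.toSpanSingleton_apply, smul_eq_mul]
  congr 1
  have := unit_ne_zero (δ j)
  rw [mul_inv]
  field_simp

lemma measurableSet_inter_preimage {V : Set (Fin n → ℝ)} (hV : IsOpen V)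
    {φ : (Fin n → ℝ) → EuclideanSpace ℂ (Fin n)} (hφ : ContinuousOn φ V)
    {A : Set (EuclideanSpace ℂ (Fin n))} (hA : MeasurableSet A) :
    MeasurableSet (V ∩ φ ⁻¹' A) := by
  have h : V ∩ φ ⁻¹' A = Subtype.val '' (V.domRestrict φ ⁻¹' A) := by
    ext x
    simp [Set.domRestrict_apply, and_comm]
  rw [h]
  exact hV.measurableSet.subtype_image (hφ.domRestrict.measurable hA)

/-- The integral over `Γ` of a function against `d(arg f₁) ∧ ⋯ ∧ d(arg fₙ)`, computed in any
positively oriented parametrization, is the sum over the sheets of the integrals over the angles. -/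
theorem Parametrization.sum_integral_eq [Fintype ι] (P : Parametrization f Γ) (S : Sheets f Γ ε ι)
    (hε : ∀ j, 0 < ε j) (hΓ : ∀ z ∈ Γ, ∀ j, ‖f j z‖ = ε j) (hf : ∀ j, Differentiable ℂ (f j))
    {K : NNReal} (hK : ∀ j, LipschitzOnWith K (f j) Γ) {g : EuclideanSpace ℂ (Fin n) → ℂ}
    (hg : ∀ c, IntegrableOn (fun θ => g (S.chart c θ)) (angleBox n)) :
    ∑ k, ∫ x in P.V k, pullbackDarg f (P.φ k) x • g (P.φ k x) =
      ∑ c, ∫ θ in angleBox n, g (S.chart c θ) := by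
  classical
  let E : Fin P.N → ι × (Fin n → ℤˣ) → Set (Fin n → ℝ) := fun k c => P.V k ∩ P.φ k ⁻¹' S.patch c
  let Θ : Fin P.N → ι × (Fin n → ℤˣ) → (Fin n → ℝ) → (Fin n → ℝ) :=
    fun k c x => angle f c.2 (P.φ k x)
  have hmem : ∀ k, ∀ x ∈ P.V k, ∀ j, ‖f j (P.φ k x)‖ = ε j := fun k x hx =>
    hΓ _ (P.mapsTo k hx)
  have hEm : ∀ k c, MeasurableSet (E k c) := fun k c =>
    measurableSet_inter_preimage (P.isOpen k) (P.contDiffOn k).continuousOn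
      (S.measurableSet_patch (fun j => (hf j).continuous) c)
  have hchart : ∀ k c, ∀ x ∈ E k c, S.chart c (Θ k c x) = P.φ k x := fun k c x hx =>
    S.chart_angle hx.2 (hmem k x hx.1)
  have hinj : ∀ k c, Set.InjOn (Θ k c) (E k c) := fun k c x hx y hy hxy =>
    P.injOn k hx.1 hy.1 (by rw [← hchart k c x hx, ← hchart k c y hy, hxy])
  have hder : ∀ k c, ∀ x ∈ E k c,
      HasFDerivWithinAt (Θ k c) (dangle f (P.φ k) x) (E k c) x := fun k c x hx =>
    (hasFDerivAt_angle hf (((P.contDiffOn k).differentiableOn one_ne_zero).differentiableAt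
      ((P.isOpen k).mem_nhds hx.1)) hx.2.1).hasFDerivWithinAt
  have hsub : ∀ k c, Θ k c '' E k c ⊆ angleBox n := by
    rintro k c _ ⟨x, hx, rfl⟩
    exact S.angle_mem hx.2
  have himm : ∀ k c, MeasurableSet (Θ k c '' E k c) := fun k c =>
    measurable_image_of_fderivWithin (hEm k c) (hder k c) (hinj k c)
  -- Positive orientation removes the absolute value from the change of variables formula.
  have hcong : ∀ k c, Set.EqOn
      (fun x => |(dangle f (P.φ k) x).det| • g (S.chart c (Θ k c x)))
      (fun x => pullbackDarg f (P.φ k) x • g (P.φ k x)) (E k c) := by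
    intro k c x hx
    simp only [det_dangle, hchart k c x hx, abs_of_pos (P.oriented k x hx.1)]
  have hV : ∀ k, P.V k = ⋃ c, E k c := by
    intro k
    rw [← Set.inter_iUnion, eq_comm, Set.inter_eq_left]
    intro x hx
    obtain ⟨c, hc⟩ := S.exists_patch hε hΓ (P.mapsTo k hx)
    exact Set.mem_iUnion.2 ⟨c, hc⟩
  have hint : ∀ k c, IntegrableOn (fun x => pullbackDarg f (P.φ k) x • g (P.φ k x)) (E k c) := by
    intro k c
    refine ((integrableOn_image_iff_integrableOn_abs_det_fderiv_smul volume (hEm k c) (hder k c)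
      (hinj k c) (fun θ => g (S.chart c θ))).1 ((hg c).mono_set (hsub k c))).congr_fun
      (hcong k c) (hEm k c)
  have hpiece : ∀ k, ∫ x in P.V k, pullbackDarg f (P.φ k) x • g (P.φ k x) =
      ∑ c, ∫ θ in Θ k c '' E k c, g (S.chart c θ) := by
    intro k
    rw [hV k, integral_iUnion_fintype (hEm k) _ (hint k)]
    · refine Finset.sum_congr rfl fun c _ => ?_
      rw [integral_image_eq_integral_abs_det_fderiv_smul volume (hEm k c) (hder k c) (hinj k c)]
      exact (setIntegral_congr_fun (hEm k c) (hcong k c)).symm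
    · intro c c' hcc
      refine Set.disjoint_left.2 fun x hx hx' => hcc ?_
      exact S.patch_unique (hmem k x hx.1) hx.2 hx'.2
  simp_rw [hpiece]
  rw [Finset.sum_comm]
  refine Finset.sum_congr rfl fun c _ => ?_
  rw [← integral_iUnion_fintype (fun k => himm k c) _
    (fun k => (hg c).mono_set (hsub k c))]
  -- The images of the pieces are disjoint subsets of the angle box. What they miss is the angle
  -- image of the uncovered part of Γ, a null set by the Lipschitz bound.
  · refine setIntegral_congr_set ?_
    refine (LE.le.eventuallyLE (Set.iUnion_subset fun k => hsub k c)).antisymm ?_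
    rw [ae_le_set]
    obtain ⟨K', hK'⟩ := S.lipschitzOnWith_angle hε hΓ hK c
    have hnull : volume (angle f c.2 ''
        ((Γ \ ⋃ k, P.φ k '' P.V k) ∩ (Γ ∩ S.patch c))) = 0 := by
      have h1 := (hK'.mono Set.inter_subset_right).hausdorffMeasure_image_le (d := n)
        (s := (Γ \ ⋃ k, P.φ k '' P.V k) ∩ (Γ ∩ S.patch c)) (Nat.cast_nonneg n)
      rw [measure_mono_null Set.inter_subset_left P.covers, mul_zero] at h1
      have h2 := hausdorffMeasure_pi_real (ι := Fin n)
      rw [Fintype.card_fin] at h2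
      rw [← h2]
      exact le_antisymm h1 bot_le
    refine measure_mono_null ?_ hnull
    intro θ hθ
    refine ⟨S.chart c θ, ⟨⟨S.chart_mem hε c θ, fun hmem' => hθ.2 ?_⟩, S.chart_mem hε c θ,
      S.chart_mem_patch hε c hθ.1⟩, S.angle_chart hε c hθ.1⟩
    obtain ⟨k, x, hx, hxe⟩ := Set.mem_iUnion.1 hmem'
    refine Set.mem_iUnion.2 ⟨k, x, ⟨hx, ?_⟩, ?_⟩
    · rw [Set.mem_preimage, hxe]
      exact S.chart_mem_patch hε c hθ.1
    · show angle f c.2 (P.φ k x) = θ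
      rw [hxe, S.angle_chart hε c hθ.1]
  · intro k l hkl
    refine Set.disjoint_left.2 ?_
    rintro _ ⟨x, hx, rfl⟩ ⟨y, hy, hxy⟩
    refine Set.disjoint_left.1 (P.disjoint k l hkl) ⟨x, hx.1, rfl⟩ ⟨y, hy.1, ?_⟩
    rw [← hchart k c x hx, ← hchart l c y hy, hxy]

end Area

/-! ### Comparison of dz₁∧⋯∧dzₙ with d(arg f₁)∧⋯∧d(arg fₙ) on Γ. -/

section Pullback

variable {f : Fin n → EuclideanSpace ℂ (Fin n) → ℂ}

/-- Differentiating the constant |G|² shows that dG / G is purely imaginary, so dG = iG d(arg G). -/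
lemma ofReal_im_mul_I_of_norm_const {V : Set (Fin n → ℝ)} (hV : IsOpen V)
    {G : (Fin n → ℝ) → ℂ} {r : ℝ} (hr : 0 < r) (hG : ∀ y ∈ V, ‖G y‖ = r) {x : Fin n → ℝ}
    (hx : x ∈ V) (hd : DifferentiableAt ℝ G x) (v : Fin n → ℝ) :
    fderiv ℝ G x v = Complex.I * G x * ((fderiv ℝ G x v / G x).im : ℝ) := by
  have hG0 : G x ≠ 0 := by
    rw [← norm_pos_iff, hG x hx]; exact hr
  have h1 : HasFDerivAt (fun y => inner ℝ (G y) (G y)) _ x := hd.hasFDerivAt.inner ℝ hd.hasFDerivAt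
  have h2 : (fun y => inner ℝ (G y) (G y)) =ᶠ[nhds x] fun _ => r ^ 2 := by
    filter_upwards [hV.mem_nhds hx] with y hy
    rw [real_inner_self_eq_norm_sq, hG y hy]
  have h3 := (h1.congr_of_eventuallyEq h2.symm).unique (hasFDerivAt_const (r ^ 2) x)
  have h4 := congrArg (fun L => L v) h3
  simp [Complex.inner] at h4
  have h5 : (fderiv ℝ G x v / G x).re = 0 := by
    rw [Complex.div_re, ← add_div]
    rw [div_eq_zero_iff]
    left
    linarith
  have h6 : fderiv ℝ G x v = G x * (fderiv ℝ G x v / G x) := by field_simp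
  conv_lhs => rw [h6, ← Complex.re_add_im (fderiv ℝ G x v / G x), h5]
  push_cast
  ring

lemma det_fderiv_comp_eq_jacobian_mul {φ : (Fin n → ℝ) → EuclideanSpace ℂ (Fin n)}
    {x : Fin n → ℝ} (hf : ∀ j, Differentiable ℂ (f j)) (hφ : DifferentiableAt ℝ φ x) :
    (Matrix.of fun i j : Fin n => fderiv ℝ (fun y => f i (φ y)) x (Pi.single j 1)).det =
      jacobian f (φ x) * pullbackDz φ x := by
  rw [jacobian, pullbackDz, ← Matrix.det_mul]
  congr 1
  ext i j
  have h1 : HasFDerivAt (fun y => f i (φ y))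
      (((fderiv ℂ (f i) (φ x)).restrictScalars ℝ) ∘L fderiv ℝ φ x) x :=
    ((hf i (φ x)).hasFDerivAt.restrictScalars ℝ).comp x hφ.hasFDerivAt
  rw [Matrix.of_apply, h1.fderiv, Matrix.mul_apply]
  simp only [ContinuousLinearMap.comp_apply, ContinuousLinearMap.coe_restrictScalars',
    Matrix.of_apply]
  conv_lhs => rw [← (EuclideanSpace.basisFun (Fin n) ℂ).sum_repr (fderiv ℝ φ x (Pi.single j 1))]
  rw [map_sum]
  refine Finset.sum_congr rfl fun k _ => ?_
  simp [mul_comm]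

/-- Both sides are the pull-back of df₁∧⋯∧dfₙ: by the chain rule on the left, and by dfⱼ = i fⱼ
d(arg fⱼ) row by row on the right. -/
lemma jacobian_mul_pullbackDz {φ : (Fin n → ℝ) → EuclideanSpace ℂ (Fin n)}
    {V : Set (Fin n → ℝ)} (hV : IsOpen V) {ε : Fin n → ℝ} (hε : ∀ j, 0 < ε j)
    (hφV : ∀ y ∈ V, ∀ j, ‖f j (φ y)‖ = ε j)
    {x : Fin n → ℝ} (hx : x ∈ V) (hf : ∀ j, Differentiable ℂ (f j))
    (hφ : DifferentiableAt ℝ φ x) :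
    jacobian f (φ x) * pullbackDz φ x =
      Complex.I ^ n * (∏ j, f j (φ x)) * pullbackDarg f φ x := by
  rw [← det_fderiv_comp_eq_jacobian_mul hf hφ, pullbackDarg]
  have h1 : (Matrix.of fun i j : Fin n => fderiv ℝ (fun y => f i (φ y)) x (Pi.single j 1)) =
      Matrix.of fun i j : Fin n => (Complex.I * f i (φ x)) *
        (((fderiv ℝ (fun y => f i (φ y)) x (Pi.single j 1) / f i (φ x)).im : ℝ) : ℂ) := by
    ext i j
    exact ofReal_im_mul_I_of_norm_const hV (hε i) (fun y hy => hφV y hy i) hx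
      (((hf i (φ x)).restrictScalars ℝ).comp x hφ) _
  rw [h1]
  have h2 := Matrix.det_mul_column (fun i => Complex.I * f i (φ x)) (Matrix.of fun i j : Fin n =>
        (((fderiv ℝ (fun y => f i (φ y)) x (Pi.single j 1) / f i (φ x)).im : ℝ) : ℂ))
  simp only [Matrix.of_apply] at h2
  rw [h2, Finset.prod_mul_distrib, Finset.prod_const, Finset.card_univ, Fintype.card_fin]
  congr 1
  exact (RingHom.map_det Complex.ofRealHom _).symm

/-- The integral over `Γ` in terms of `d(arg f₁) ∧ ⋯ ∧ d(arg fₙ)`. -/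
theorem Parametrization.integral_eq {Γ : Set (EuclideanSpace ℂ (Fin n))} {ε : Fin n → ℝ}
    (P : Parametrization f Γ) (hε : ∀ j, 0 < ε j) (hΓ : ∀ z ∈ Γ, ∀ j, ‖f j z‖ = ε j)
    (hf : ∀ j, Differentiable ℂ (f j)) (hreg : ∀ z ∈ Γ, jacobian f z ≠ 0)
    (h : EuclideanSpace ℂ (Fin n) → ℂ) :
    P.integral h = Complex.I ^ n * ∑ k, ∫ x in P.V k,
      pullbackDarg f (P.φ k) x • (h (P.φ k x) / jacobian f (P.φ k x)) := by
  rw [Parametrization.integral, Finset.mul_sum]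
  refine Finset.sum_congr rfl fun k _ => ?_
  rw [← integral_const_mul]
  refine setIntegral_congr_fun (P.isOpen k).measurableSet fun x hx => ?_
  have hx' := P.mapsTo k hx
  have h1 := jacobian_mul_pullbackDz (P.isOpen k) hε (fun y hy => hΓ _ (P.mapsTo k hy)) hx hf
    (((P.contDiffOn k).differentiableOn one_ne_zero).differentiableAt ((P.isOpen k).mem_nhds hx))
  have h2 : ∏ j, f j (P.φ k x) ≠ 0 := Finset.prod_ne_zero_iff.2 fun j _ => by
    rw [← norm_pos_iff, hΓ _ hx' j]; exact hε j
  have h3 := hreg _ hx'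
  simp only [Complex.real_smul]
  field_simp
  linear_combination h (P.φ k x) * h1

end Pullback

/-! ### Rotations about ξ acting on parametrizations. -/

section Rotation

variable {f : Fin n → EuclideanSpace ℂ (Fin n) → ℂ} {Γ : Set (EuclideanSpace ℂ (Fin n))}

/-- Multiplication by a scalar about a centre. -/
def scale (ξ : EuclideanSpace ℂ (Fin n)) (t : ℂ) (z : EuclideanSpace ℂ (Fin n)) :
    EuclideanSpace ℂ (Fin n) :=
  ξ + t • (z - ξ)

lemma isometry_scale (ξ : EuclideanSpace ℂ (Fin n)) {t : ℂ} (ht : ‖t‖ = 1) :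
    Isometry (scale ξ t) := by
  refine Isometry.of_dist_eq fun x y => ?_
  rw [scale, scale, dist_add_left, dist_eq_norm, dist_eq_norm, ← smul_sub, norm_smul, ht, one_mul,
    sub_sub_sub_cancel_right]

lemma scale_scale_inv (ξ : EuclideanSpace ℂ (Fin n)) {t : ℂ} (ht : t ≠ 0)
    (z : EuclideanSpace ℂ (Fin n)) : scale ξ t (scale ξ t⁻¹ z) = z := by
  simp [scale, smul_smul, ht]

/-- The factors cⱼ cancel in the logarithmic derivatives of the fⱼ. -/
lemma pullbackDarg_scale (φ : (Fin n → ℝ) → EuclideanSpace ℂ (Fin n))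
    (ξ : EuclideanSpace ℂ (Fin n)) {t : ℂ}
    (c : Fin n → ℂ) (hc : ∀ j, c j ≠ 0)
    (hfc : ∀ j z, f j (scale ξ t z) = c j * f j z) (x : Fin n → ℝ) :
    pullbackDarg f (fun y => scale ξ t (φ y)) x = pullbackDarg f φ x := by
  simp only [pullbackDarg]
  congr 2
  ext i j
  simp only [hfc]
  rw [show (fun y => c i * f i (φ y)) = c i • fun y => f i (φ y) from rfl,
    fderiv_const_smul_field, Pi.smul_apply, smul_apply, smul_eq_mul,
    mul_div_mul_left _ _ (hc i)]

/-- The image of a parametrization under a rotation about `ξ` for which the `fⱼ` are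
homogeneous. -/
def Parametrization.rotate (P : Parametrization f Γ) (ξ : EuclideanSpace ℂ (Fin n)) {t : ℂ}
    (ht : ‖t‖ = 1) (c : Fin n → ℂ) (hc : ∀ j, c j ≠ 0)
    (hfc : ∀ j z, f j (scale ξ t z) = c j * f j z)
    (hΓ : ∀ z ∈ Γ, scale ξ t z ∈ Γ) (hΓ' : ∀ z ∈ Γ, scale ξ t⁻¹ z ∈ Γ) :
    Parametrization f Γ where
  N := P.N
  V := P.V
  φ k x := scale ξ t (P.φ k x)
  isOpen := P.isOpen
  contDiffOn k := contDiffOn_const.add (((P.contDiffOn k).sub contDiffOn_const).const_smul t)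
  injOn k := fun x hx y hy hxy => P.injOn k hx hy ((isometry_scale ξ ht).injective hxy)
  mapsTo k x hx := hΓ _ (P.mapsTo k hx)
  oriented k x hx := by
    rw [pullbackDarg_scale _ ξ c hc hfc]
    exact P.oriented k x hx
  disjoint k l hkl := by
    have h : ∀ k, (fun x => scale ξ t (P.φ k x)) '' P.V k = scale ξ t '' (P.φ k '' P.V k) :=
      fun k => by rw [Set.image_image]
    rw [h, h]
    exact (Set.disjoint_image_iff (isometry_scale ξ ht).injective).2 (P.disjoint k l hkl)
  covers := by
    have ht0 : t ≠ 0 := by rw [← norm_pos_iff, ht]; exact one_pos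
    refine measure_mono_null ?_
      (((isometry_scale ξ ht).hausdorffMeasure_image (Or.inl (Nat.cast_nonneg n)) _).trans P.covers)
    rintro z ⟨hz, hz'⟩
    refine ⟨scale ξ t⁻¹ z, ⟨hΓ' z hz, fun hm => hz' ?_⟩, scale_scale_inv ξ ht0 z⟩
    obtain ⟨k, x, hx, hxe⟩ := Set.mem_iUnion.1 hm
    refine Set.mem_iUnion.2 ⟨k, x, hx, ?_⟩
    show scale ξ t (P.φ k x) = z
    rw [hxe, scale_scale_inv ξ ht0]

end Rotation

end General

/-! ### Contours of {l₁l₂, l₃} and their two sheets. -/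

/-- The function list `{l₁ l₂, l₃}` for linear forms centred at `ξ`. -/
def lineList (ξ : EuclideanSpace ℂ (Fin 2)) (l₁ l₂ l₃ : EuclideanSpace ℂ (Fin 2) →L[ℂ] ℂ) :
    Fin 2 → EuclideanSpace ℂ (Fin 2) → ℂ :=
  ![fun z => l₁ (z - ξ) * l₂ (z - ξ), fun z => l₃ (z - ξ)]

/-- The determinant of two linear forms in the standard coordinates. -/
def formDet (l l' : EuclideanSpace ℂ (Fin 2) →L[ℂ] ℂ) : ℂ :=
  l (EuclideanSpace.single 0 1) * l' (EuclideanSpace.single 1 1) -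
    l (EuclideanSpace.single 1 1) * l' (EuclideanSpace.single 0 1)

/-- The vectors `e₁, e₂` form the basis dual to the linear forms `l₁, l₃`. -/
structure IsDualBasis (l₁ l₃ : EuclideanSpace ℂ (Fin 2) →L[ℂ] ℂ)
    (e₁ e₂ : EuclideanSpace ℂ (Fin 2)) : Prop where
  apply₁₁ : l₁ e₁ = 1
  apply₁₂ : l₁ e₂ = 0
  apply₃₁ : l₃ e₁ = 0
  apply₃₂ : l₃ e₂ = 1
  eq_add : ∀ w, w = l₁ w • e₁ + l₃ w • e₂

section

variable {ξ : EuclideanSpace ℂ (Fin 2)} {l₁ l₂ l₃ : EuclideanSpace ℂ (Fin 2) →L[ℂ] ℂ}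
  {e₁ e₂ : EuclideanSpace ℂ (Fin 2)} {h : EuclideanSpace ℂ (Fin 2) → ℂ} {ρ : ℝ} {ε : Fin 2 → ℝ}

lemma IsDualBasis.apply_eq (hd : IsDualBasis l₁ l₃ e₁ e₂) (w : EuclideanSpace ℂ (Fin 2)) :
    l₂ w = l₂ e₁ * l₁ w + l₂ e₂ * l₃ w := by
  conv_lhs => rw [hd.eq_add w]
  simp [mul_comm]

lemma differentiable_lineList (j : Fin 2) : Differentiable ℂ (lineList ξ l₁ l₂ l₃ j) := by
  fin_cases j
  · change Differentiable ℂ fun z => l₁ (z - ξ) * l₂ (z - ξ)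
    fun_prop
  · change Differentiable ℂ fun z => l₃ (z - ξ)
    fun_prop

lemma lineList_scale (t : ℂ) (j : Fin 2) (z : EuclideanSpace ℂ (Fin 2)) :
    lineList ξ l₁ l₂ l₃ j (scale ξ t z) = ![t ^ 2, t] j * lineList ξ l₁ l₂ l₃ j z := by
  fin_cases j
  · simp [lineList, scale]; ring
  · simp [lineList, scale]

lemma jacobian_lineList (hd : IsDualBasis l₁ l₃ e₁ e₂) (z : EuclideanSpace ℂ (Fin 2)) :
    jacobian (lineList ξ l₁ l₂ l₃) z =
      (2 * l₂ e₁ * l₁ (z - ξ) + l₂ e₂ * l₃ (z - ξ)) * formDet l₁ l₃ := by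
  have hs : HasFDerivAt (fun z : EuclideanSpace ℂ (Fin 2) => z - ξ)
      (ContinuousLinearMap.id ℂ _) z := (hasFDerivAt_id z).sub_const ξ
  have h0 : HasFDerivAt (fun z => l₁ (z - ξ) * l₂ (z - ξ)) _ z :=
    (l₁.hasFDerivAt.comp z hs).mul (l₂.hasFDerivAt.comp z hs)
  have h1 : HasFDerivAt (fun z => l₃ (z - ξ)) _ z := l₃.hasFDerivAt.comp z hs
  rw [jacobian, Matrix.det_fin_two]
  simp only [Matrix.of_apply, lineList, Matrix.cons_val_zero, Matrix.cons_val_one]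
  rw [h0.fderiv, h1.fderiv]
  simp only [add_apply, smul_apply, ContinuousLinearMap.comp_apply,
    ContinuousLinearMap.id_apply, smul_eq_mul, Function.comp_apply]
  rw [hd.apply_eq (l₂ := l₂) (z - ξ), hd.apply_eq (l₂ := l₂) (EuclideanSpace.single 0 1),
    hd.apply_eq (l₂ := l₂) (EuclideanSpace.single 1 1), formDet]
  ring

/-- A point outside the ball could be pulled radially onto the sphere; by homogeneity this does not
increase the moduli, contradicting `IsAdmissible.small`. So the modulus equations alone define Γ,
which makes it closed and rotation invariant. -/
lemma mem_ball_of_norm_le (hA : IsAdmissible (lineList ξ l₁ l₂ l₃) h ξ ρ ε)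
    {z : EuclideanSpace ℂ (Fin 2)} (hz : ∀ j, ‖lineList ξ l₁ l₂ l₃ j z‖ ≤ ε j) :
    z ∈ ball ξ ρ := by
  by_contra hzb
  rw [mem_ball, not_lt, dist_eq_norm] at hzb
  have hn : 0 < ‖z - ξ‖ := hA.rho_pos.trans_le hzb
  set t : ℝ := ρ / ‖z - ξ‖ with ht
  have ht0 : 0 ≤ t := div_nonneg hA.rho_pos.le hn.le
  have ht1 : t ≤ 1 := (div_le_one hn).2 hzb
  have hdist : dist (scale ξ t z) ξ = ρ := by
    rw [scale, dist_eq_norm, add_sub_cancel_left, norm_smul, Complex.norm_real,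
      Real.norm_of_nonneg ht0, ht, div_mul_cancel₀ _ hn.ne']
  have hmem := hA.small (scale ξ t z) (mem_closedBall.2 hdist.le) fun j => ?_
  · rw [mem_ball, hdist] at hmem
    exact lt_irrefl _ hmem
  · rw [lineList_scale, norm_mul]
    have : ‖(![(t : ℂ) ^ 2, (t : ℂ)] : Fin 2 → ℂ) j‖ ≤ 1 := by
      fin_cases j
      · simpa [abs_of_nonneg ht0] using ht1
      · simpa [abs_of_nonneg ht0] using ht1
    calc _ ≤ 1 * ‖lineList ξ l₁ l₂ l₃ j z‖ := by gcongr
      _ ≤ ε j := by rw [one_mul]; exact hz j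

lemma mem_cycle_iff (hA : IsAdmissible (lineList ξ l₁ l₂ l₃) h ξ ρ ε)
    {z : EuclideanSpace ℂ (Fin 2)} :
    z ∈ cycle (lineList ξ l₁ l₂ l₃) ξ ρ ε ↔ ∀ j, ‖lineList ξ l₁ l₂ l₃ j z‖ = ε j :=
  ⟨fun hz => hz.2, fun hz => ⟨mem_ball_of_norm_le hA fun j => (hz j).le, hz⟩⟩

lemma isCompact_cycle (hA : IsAdmissible (lineList ξ l₁ l₂ l₃) h ξ ρ ε) :
    IsCompact (cycle (lineList ξ l₁ l₂ l₃) ξ ρ ε) := by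
  refine (isCompact_closedBall ξ ρ).of_isClosed_subset ?_
    fun z hz => ball_subset_closedBall hz.1
  have : cycle (lineList ξ l₁ l₂ l₃) ξ ρ ε =
      ⋂ j, {z | ‖lineList ξ l₁ l₂ l₃ j z‖ = ε j} := by
    ext z
    simp [mem_cycle_iff hA]
  rw [this]
  exact isClosed_iInter fun j =>
    isClosed_eq (differentiable_lineList j).continuous.norm continuous_const

lemma scale_mem_cycle (hA : IsAdmissible (lineList ξ l₁ l₂ l₃) h ξ ρ ε) {t : ℂ} (ht : ‖t‖ = 1)
    {z : EuclideanSpace ℂ (Fin 2)} (hz : z ∈ cycle (lineList ξ l₁ l₂ l₃) ξ ρ ε) :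
    scale ξ t z ∈ cycle (lineList ξ l₁ l₂ l₃) ξ ρ ε := by
  rw [mem_cycle_iff hA] at hz ⊢
  intro j
  rw [lineList_scale, norm_mul, hz]
  fin_cases j <;> simp [ht]

lemma exists_lipschitzOnWith_lineList (ξ : EuclideanSpace ℂ (Fin 2))
    (l₁ l₂ l₃ : EuclideanSpace ℂ (Fin 2) →L[ℂ] ℂ) (ρ : ℝ) :
    ∃ K, ∀ j, LipschitzOnWith K (lineList ξ l₁ l₂ l₃ j) (closedBall ξ ρ) := by
  have hC : ∀ j, ∃ K, LipschitzOnWith K (lineList ξ l₁ l₂ l₃ j) (closedBall ξ ρ) := by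
    intro j
    have hcd : ContDiff ℂ 1 (lineList ξ l₁ l₂ l₃ j) := by
      fin_cases j
      · change ContDiff ℂ 1 fun z => l₁ (z - ξ) * l₂ (z - ξ)
        fun_prop
      · change ContDiff ℂ 1 fun z => l₃ (z - ξ)
        fun_prop
    exact (hcd.restrict_scalars ℝ).contDiffOn.exists_lipschitzOnWith one_ne_zero (convex_closedBall ξ ρ)
      (isCompact_closedBall ξ ρ)
  choose K hK using hC
  exact ⟨max (K 0) (K 1), fun j => (hK j).weaken (by fin_cases j <;> simp)⟩

/-- A root of `a u² + b v u = s`, with `(s, v) = w` and `σ` the sign of the square root of the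
discriminant. -/
def quadRoot (a b : ℂ) (σ : ℤˣ) (w : Fin 2 → ℂ) : ℂ :=
  (-(b * w 1) + ((σ : ℤ) : ℂ) * (b ^ 2 * w 1 ^ 2 + 4 * a * w 0) ^ (1 / 2 : ℂ)) / (2 * a)

lemma measurable_quadRoot (a b : ℂ) (σ : ℤˣ) : Measurable (quadRoot a b σ) := by
  unfold quadRoot
  fun_prop

lemma sqrt_sq (x : ℂ) : (x ^ (1 / 2 : ℂ)) ^ 2 = x := by
  have := Complex.cpow_nat_inv_pow x two_ne_zero
  simpa only [one_div, Nat.cast_ofNat] using this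

lemma two_mul_quadRoot {a : ℂ} (ha : a ≠ 0) (b : ℂ) (σ : ℤˣ) (w : Fin 2 → ℂ) :
    2 * a * quadRoot a b σ w + b * w 1 =
      ((σ : ℤ) : ℂ) * (b ^ 2 * w 1 ^ 2 + 4 * a * w 0) ^ (1 / 2 : ℂ) := by
  rw [quadRoot]
  field_simp
  ring

lemma quadRoot_eq {a : ℂ} (ha : a ≠ 0) (b : ℂ) (σ : ℤˣ) (w : Fin 2 → ℂ) :
    quadRoot a b σ w * (a * quadRoot a b σ w + b * w 1) = w 0 := by
  have h1 := two_mul_quadRoot ha b σ w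
  have h2 := sqrt_sq (b ^ 2 * w 1 ^ 2 + 4 * a * w 0)
  have h3 := unit_mul_self σ
  have h4 : (2 * a * quadRoot a b σ w + b * w 1) ^ 2 = b ^ 2 * w 1 ^ 2 + 4 * a * w 0 := by
    rw [h1, mul_pow, h2, sq, h3, one_mul]
  have h5 : (4 * a) ≠ 0 := by simpa using ha
  apply mul_left_cancel₀ h5
  linear_combination h4

/-- Multiplying the quadratic equation by 4a and completing the square leaves two opposite square
roots of the discriminant. -/
lemma exists_quadRoot_eq {a : ℂ} (ha : a ≠ 0) (b : ℂ) {u : ℂ} {w : Fin 2 → ℂ}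
    (hu : u * (a * u + b * w 1) = w 0) : ∃ σ, quadRoot a b σ w = u := by
  have h4 : (2 * a * u + b * w 1) ^ 2 = ((b ^ 2 * w 1 ^ 2 + 4 * a * w 0) ^ (1 / 2 : ℂ)) ^ 2 := by
    rw [sqrt_sq]
    linear_combination 4 * a * hu
  rcases sq_eq_sq_iff_eq_or_eq_neg.1 h4 with h | h
  · refine ⟨1, ?_⟩
    rw [quadRoot]
    field_simp
    push_cast
    linear_combination -h
  · refine ⟨-1, ?_⟩
    rw [quadRoot]
    field_simp
    push_cast
    linear_combination -h

lemma lineList_add (hd : IsDualBasis l₁ l₃ e₁ e₂) (u v : ℂ) :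
    (fun j => lineList ξ l₁ l₂ l₃ j (ξ + (u • e₁ + v • e₂))) =
      ![u * (l₂ e₁ * u + l₂ e₂ * v), v] := by
  ext j
  fin_cases j
  · simp [lineList, hd.apply₁₁, hd.apply₁₂, mul_comm]
  · simp [lineList, hd.apply₃₁, hd.apply₃₂]

lemma jacobian_lineList_add (hd : IsDualBasis l₁ l₃ e₁ e₂) (u v : ℂ) :
    jacobian (lineList ξ l₁ l₂ l₃) (ξ + (u • e₁ + v • e₂)) =
      (2 * l₂ e₁ * u + l₂ e₂ * v) * formDet l₁ l₃ := by
  rw [jacobian_lineList hd]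
  simp [hd.apply₁₁, hd.apply₁₂, hd.apply₃₁, hd.apply₃₂]

lemma quadRoot_mem_cycle (hA : IsAdmissible (lineList ξ l₁ l₂ l₃) h ξ ρ ε)
    (hd : IsDualBasis l₁ l₃ e₁ e₂) (ha : l₂ e₁ ≠ 0) (σ : ℤˣ) {w : Fin 2 → ℂ}
    (hw : ∀ j, ‖w j‖ = ε j) :
    ξ + (quadRoot (l₂ e₁) (l₂ e₂) σ w • e₁ + w 1 • e₂) ∈ cycle (lineList ξ l₁ l₂ l₃) ξ ρ ε := by
  rw [mem_cycle_iff hA]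
  intro j
  have h1 := congrFun (lineList_add (ξ := ξ) (l₂ := l₂) hd
    (quadRoot (l₂ e₁) (l₂ e₂) σ w) (w 1)) j
  rw [h1, quadRoot_eq ha, ← hw j]
  fin_cases j <;> rfl

/-- This factor of the Jacobian is a square root of the discriminant. Regularity of the contour thus
says that the two roots are distinct, which separates the sheets. -/
lemma two_mul_quadRoot_ne_zero (hA : IsAdmissible (lineList ξ l₁ l₂ l₃) h ξ ρ ε)
    (hd : IsDualBasis l₁ l₃ e₁ e₂) (ha : l₂ e₁ ≠ 0) (σ : ℤˣ) {w : Fin 2 → ℂ}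
    (hw : ∀ j, ‖w j‖ = ε j) :
    2 * l₂ e₁ * quadRoot (l₂ e₁) (l₂ e₂) σ w + l₂ e₂ * w 1 ≠ 0 := by
  have h1 := hA.regular _ (quadRoot_mem_cycle hA hd ha σ hw)
  rw [jacobian_lineList_add hd] at h1
  exact left_ne_zero_of_mul h1

/-- The two sheets of the contour of `{l₁ l₂, l₃}`. -/
def lineSheets (hA : IsAdmissible (lineList ξ l₁ l₂ l₃) h ξ ρ ε)
    (hd : IsDualBasis l₁ l₃ e₁ e₂) (ha : l₂ e₁ ≠ 0) :
    Sheets (lineList ξ l₁ l₂ l₃) (cycle (lineList ξ l₁ l₂ l₃) ξ ρ ε) ε ℤˣ where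
  sec σ w := ξ + (quadRoot (l₂ e₁) (l₂ e₂) σ w • e₁ + w 1 • e₂)
  measurable_sec σ := measurable_const.add
    (((measurable_quadRoot _ _ σ).smul_const e₁).add ((measurable_pi_apply 1).smul_const e₂))
  sec_mem σ w hw := quadRoot_mem_cycle hA hd ha σ hw
  apply_sec σ w hw j := by
    rw [congrFun (lineList_add (ξ := ξ) (l₂ := l₂) hd _ (w 1)) j, quadRoot_eq ha]
    fin_cases j <;> rfl
  exists_sec z hz := by
    obtain ⟨σ, hσ⟩ := exists_quadRoot_eq ha (l₂ e₂) (u := l₁ (z - ξ))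
      (w := fun j => lineList ξ l₁ l₂ l₃ j z) (by
        simp only [lineList, Matrix.cons_val_zero, Matrix.cons_val_one]
        rw [hd.apply_eq (l₂ := l₂) (z - ξ)])
    refine ⟨σ, ?_⟩
    rw [hσ]
    change ξ + (l₁ (z - ξ) • e₁ + l₃ (z - ξ) • e₂) = z
    rw [← hd.eq_add (z - ξ), add_sub_cancel]
  sec_ne w hw σ σ' hne heq := by
    have h1 := congrArg l₁ heq
    simp [hd.apply₁₁, hd.apply₁₂] at h1
    have h2 := two_mul_quadRoot ha (l₂ e₂) σ w
    have h3 := two_mul_quadRoot ha (l₂ e₂) σ' w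
    rw [h1, h3] at h2
    have h4 := two_mul_quadRoot_ne_zero hA hd ha σ' hw
    rw [h3] at h4
    have h5 := mul_right_cancel₀ (right_ne_zero_of_mul h4) h2
    exact hne (Units.ext (by exact_mod_cast h5.symm))

end

/-! ### Evaluation of the residue integral. -/

lemma measurable_comp_of_continuousOn {X Y : Type*} [MeasurableSpace X] [TopologicalSpace Y]
    [MeasurableSpace Y] [BorelSpace Y] {Γ : Set Y} {g : Y → ℂ}
    (hg : ContinuousOn g Γ) {q : X → Y} (hq : Measurable q) (hqΓ : ∀ x, q x ∈ Γ) :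
    Measurable fun x => g (q x) :=
  hg.domRestrict.measurable.comp (hq.subtype_mk (h := hqΓ))

lemma integrable_comp_of_continuousOn {X Y : Type*} [MeasurableSpace X] [TopologicalSpace Y]
    [MeasurableSpace Y] [BorelSpace Y] {μ : Measure X} [IsFiniteMeasure μ] {Γ : Set Y}
    (hΓ : IsCompact Γ) {g : Y → ℂ}
    (hg : ContinuousOn g Γ) {q : X → Y} (hq : Measurable q) (hqΓ : ∀ x, q x ∈ Γ) :
    Integrable (fun x => g (q x)) μ := by
  obtain ⟨C, hC⟩ := hΓ.exists_bound_of_continuousOn hg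
  exact Integrable.of_bound (measurable_comp_of_continuousOn hg hq hqΓ).aestronglyMeasurable C
    (Filter.Eventually.of_forall fun x => hC _ (hqΓ x))

lemma volume_real_angleBox (n : ℕ) : volume.real (angleBox n) = Real.pi ^ n := by
  rw [angleBox, Measure.real, Real.volume_pi_Ico_toReal]
  · simp
  · intro i
    show -(Real.pi / 2) ≤ Real.pi / 2
    linarith [Real.pi_pos]

lemma volume_angleBox_lt_top (n : ℕ) : volume (angleBox n) < ⊤ := by
  rw [angleBox, Real.volume_pi_Ico]
  exact ENNReal.prod_lt_top fun i _ => ENNReal.ofReal_lt_top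

instance (n : ℕ) : IsFiniteMeasure (volume.restrict (angleBox n)) :=
  ⟨by rw [Measure.restrict_apply_univ]; exact volume_angleBox_lt_top n⟩

/-- Cauchy's formula for the derivative at the centre of the unit disc; the factor exp(-iα) will
come from the homogeneity of the Jacobian. -/
lemma intervalIntegral_exp_neg_mul_eq_deriv {H : ℂ → ℂ}
    (hH : DifferentiableOn ℂ H (closedBall 0 1)) :
    ∫ α in (0 : ℝ)..2 * Real.pi, (Complex.exp (α * Complex.I))⁻¹ * H (Complex.exp (α * Complex.I))
      = 2 * Real.pi * deriv H 0 := by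
  have h1 := hH.deriv_eq_smul_circleIntegral one_pos
  rw [circleIntegral] at h1
  apply mul_left_cancel₀ Complex.I_ne_zero
  rw [← intervalIntegral.integral_const_mul]
  rw [show Complex.I * (2 * Real.pi * deriv H 0) = (2 * Real.pi * Complex.I) • deriv H 0 by
    rw [smul_eq_mul]; ring, ← h1]
  refine intervalIntegral.integral_congr fun α _ => ?_
  simp only [deriv_circleMap, circleMap, Complex.ofReal_one, one_mul, zero_add, sub_zero,
    smul_eq_mul]
  have := Complex.exp_ne_zero (α * Complex.I)
  field_simp

section

variable {ξ : EuclideanSpace ℂ (Fin 2)} {l₁ l₂ l₃ : EuclideanSpace ℂ (Fin 2) →L[ℂ] ℂ}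
  {e₁ e₂ : EuclideanSpace ℂ (Fin 2)} {h : EuclideanSpace ℂ (Fin 2) → ℂ} {ρ : ℝ} {ε : Fin 2 → ℝ}

lemma IsAdmissible.differentiableOn_closedBall {n : ℕ}
    {f : Fin n → EuclideanSpace ℂ (Fin n) → ℂ} {h : EuclideanSpace ℂ (Fin n) → ℂ}
    {ξ : EuclideanSpace ℂ (Fin n)} {ρ : ℝ} {ε : Fin n → ℝ} (hA : IsAdmissible f h ξ ρ ε) :
    ∀ z ∈ closedBall ξ ρ, DifferentiableAt ℂ h z := by
  obtain ⟨W, hW, hWb, -, hWh⟩ := hA.holomorphic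
  exact fun z hz => hWh.differentiableAt (hW.mem_nhds (hWb hz))

lemma continuous_jacobian_lineList (hd : IsDualBasis l₁ l₃ e₁ e₂) :
    Continuous (jacobian (lineList ξ l₁ l₂ l₃)) := by
  rw [show jacobian (lineList ξ l₁ l₂ l₃) = _ from funext (jacobian_lineList hd)]
  fun_prop

lemma jacobian_lineList_scale (hd : IsDualBasis l₁ l₃ e₁ e₂) (t : ℂ)
    (z : EuclideanSpace ℂ (Fin 2)) :
    jacobian (lineList ξ l₁ l₂ l₃) (scale ξ t z) = t * jacobian (lineList ξ l₁ l₂ l₃) z := by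
  rw [jacobian_lineList hd, jacobian_lineList hd]
  simp only [scale, add_sub_cancel_left, map_smul, smul_eq_mul]
  ring

lemma continuousOn_div_jacobian (hA : IsAdmissible (lineList ξ l₁ l₂ l₃) h ξ ρ ε)
    (hd : IsDualBasis l₁ l₃ e₁ e₂) {g : EuclideanSpace ℂ (Fin 2) → ℂ}
    (hg : ContinuousOn g (cycle (lineList ξ l₁ l₂ l₃) ξ ρ ε)) :
    ContinuousOn (fun z => g z / jacobian (lineList ξ l₁ l₂ l₃) z)
      (cycle (lineList ξ l₁ l₂ l₃) ξ ρ ε) :=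
  hg.div (continuous_jacobian_lineList hd).continuousOn hA.regular

/-- Averaging over the rotations about `ξ` replaces `h` by its differential at `ξ`. -/
lemma intervalIntegral_scale_div_jacobian (hA : IsAdmissible (lineList ξ l₁ l₂ l₃) h ξ ρ ε)
    (hd : IsDualBasis l₁ l₃ e₁ e₂) {z : EuclideanSpace ℂ (Fin 2)} (hz : z ∈ ball ξ ρ) :
    ∫ α in (0 : ℝ)..2 * Real.pi, h (scale ξ (Complex.exp (α * Complex.I)) z) /
        jacobian (lineList ξ l₁ l₂ l₃) (scale ξ (Complex.exp (α * Complex.I)) z) =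
      2 * Real.pi * (fderiv ℂ h ξ (z - ξ) / jacobian (lineList ξ l₁ l₂ l₃) z) := by
  have hline : ∀ t : ℂ, HasFDerivAt (fun t : ℂ => scale ξ t z)
      ((ContinuousLinearMap.toSpanSingleton ℂ (z - ξ))) t := by
    intro t
    exact ((hasDerivAt_id t).smul_const (z - ξ)).hasFDerivAt.const_add ξ |>.congr_fderiv
      (by ext; simp)
  have hmaps : ∀ t ∈ closedBall (0 : ℂ) 1, scale ξ t z ∈ closedBall ξ ρ := by
    intro t ht
    rw [mem_closedBall, dist_zero_right] at ht
    rw [mem_ball, dist_eq_norm] at hz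
    rw [mem_closedBall, dist_eq_norm, scale, add_sub_cancel_left, norm_smul]
    calc ‖t‖ * ‖z - ξ‖ ≤ 1 * ‖z - ξ‖ := by gcongr
      _ ≤ ρ := by rw [one_mul]; exact hz.le
  have hH : DifferentiableOn ℂ (fun t : ℂ => h (scale ξ t z)) (closedBall 0 1) := fun t ht =>
    ((hA.differentiableOn_closedBall _ (hmaps t ht)).comp t
      (hline t).differentiableAt).differentiableWithinAt
  have hderiv : deriv (fun t : ℂ => h (scale ξ t z)) 0 = fderiv ℂ h ξ (z - ξ) := by
    have h0 : scale ξ 0 z = ξ := by simp [scale]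
    have h1 := hA.differentiableOn_closedBall ξ (mem_closedBall_self hA.rho_pos.le)
    have h2 : HasFDerivAt h (fderiv ℂ h ξ) (scale ξ 0 z) := by rw [h0]; exact h1.hasFDerivAt
    have h3 := (h2.comp (0 : ℂ) (hline 0)).hasDerivAt.deriv
    simpa [Function.comp_def] using h3
  have hcauchy := intervalIntegral_exp_neg_mul_eq_deriv hH
  rw [hderiv] at hcauchy
  rw [mul_div_assoc', ← hcauchy, ← intervalIntegral.integral_div]
  refine intervalIntegral.integral_congr fun α _ => ?_
  simp only [jacobian_lineList_scale hd]
  rw [div_mul_eq_div_div_swap, div_eq_inv_mul, div_eq_inv_mul, div_eq_inv_mul, mul_left_comm]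

/-- The sheets have coordinates (u, v) and (u', v) in the basis e₁, e₂, with opposite Jacobians. The
contributions of v cancel, and those of u combine to (u - u') D e₁ over l₂(e₁)(u - u') det(l₁, l₃).
-/
lemma sum_fderiv_div_jacobian (hA : IsAdmissible (lineList ξ l₁ l₂ l₃) h ξ ρ ε)
    (hd : IsDualBasis l₁ l₃ e₁ e₂) (ha : l₂ e₁ ≠ 0) (D : EuclideanSpace ℂ (Fin 2) →L[ℂ] ℂ)
    {w : Fin 2 → ℂ} (hw : ∀ j, ‖w j‖ = ε j) :
    ∑ σ, D ((lineSheets hA hd ha).sec σ w - ξ) /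
        jacobian (lineList ξ l₁ l₂ l₃) ((lineSheets hA hd ha).sec σ w) =
      D e₁ / (l₂ e₁ * formDet l₁ l₃) := by
  have hJ := hA.regular _ (quadRoot_mem_cycle hA hd ha 1 hw)
  rw [jacobian_lineList_add hd] at hJ
  have hJ0 := right_ne_zero_of_mul hJ
  have hr := left_ne_zero_of_mul hJ
  simp only [lineSheets, jacobian_lineList_add hd]
  have hu : (Finset.univ : Finset ℤˣ) = {1, -1} := by decide
  rw [hu, Finset.sum_pair (by decide)]
  have h1 := two_mul_quadRoot ha (l₂ e₂) 1 w
  have h2 := two_mul_quadRoot ha (l₂ e₂) (-1) w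
  set u := quadRoot (l₂ e₁) (l₂ e₂) 1 w
  set u' := quadRoot (l₂ e₁) (l₂ e₂) (-1) w
  have h3 : 2 * l₂ e₁ * u' + l₂ e₂ * w 1 = -(2 * l₂ e₁ * u + l₂ e₂ * w 1) := by
    rw [h1, h2]; simp
  have h4 : l₂ e₂ * w 1 = - l₂ e₁ * (u + u') := by linear_combination h3 / 2
  rw [h3]
  simp only [add_sub_cancel_left, map_add, map_smul, smul_eq_mul]
  set s := 2 * l₂ e₁ * u + l₂ e₂ * w 1 with hs
  have h5 : s = l₂ e₁ * (u - u') := by rw [hs, h4]; ring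
  have h6 : u - u' ≠ 0 := right_ne_zero_of_mul (h5 ▸ hr)
  rw [h5]
  field_simp
  ring

lemma sum_integral_fderiv_div_jacobian (hA : IsAdmissible (lineList ξ l₁ l₂ l₃) h ξ ρ ε)
    (hd : IsDualBasis l₁ l₃ e₁ e₂) (ha : l₂ e₁ ≠ 0) (D : EuclideanSpace ℂ (Fin 2) →L[ℂ] ℂ)
    (δ : Fin 2 → ℤˣ) :
    ∑ σ, ∫ θ in angleBox 2, D ((lineSheets hA hd ha).chart (σ, δ) θ - ξ) /
        jacobian (lineList ξ l₁ l₂ l₃) ((lineSheets hA hd ha).chart (σ, δ) θ) =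
      Real.pi ^ 2 * (D e₁ / (l₂ e₁ * formDet l₁ l₃)) := by
  have hε := hA.eps_pos
  have hint : ∀ σ, Integrable (fun θ => D ((lineSheets hA hd ha).chart (σ, δ) θ - ξ) /
      jacobian (lineList ξ l₁ l₂ l₃) ((lineSheets hA hd ha).chart (σ, δ) θ))
      (volume.restrict (angleBox 2)) := fun σ =>
    integrable_comp_of_continuousOn (isCompact_cycle hA)
      (g := fun z => D (z - ξ) / jacobian (lineList ξ l₁ l₂ l₃) z)
      (continuousOn_div_jacobian hA hd (by fun_prop))
      ((lineSheets hA hd ha).measurable_chart _) ((lineSheets hA hd ha).chart_mem hε _)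
  refine (integral_finsetSum _ fun σ _ => hint σ).symm.trans ?_
  have hsum : ∀ θ, ∑ σ, D ((lineSheets hA hd ha).chart (σ, δ) θ - ξ) /
      jacobian (lineList ξ l₁ l₂ l₃) ((lineSheets hA hd ha).chart (σ, δ) θ) =
      D e₁ / (l₂ e₁ * formDet l₁ l₃) := by
    intro θ
    simp only [Sheets.chart]
    exact sum_fderiv_div_jacobian hA hd ha D (norm_torusPoint hε δ θ)
  simp_rw [hsum]
  rw [setIntegral_const, volume_real_angleBox, Complex.real_smul, Complex.ofReal_pow]

set_option maxHeartbeats 400000 in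
/-- The value of the residue integral on every contour of `{l₁ l₂, l₃}`. -/
theorem integral_lineList (hA : IsAdmissible (lineList ξ l₁ l₂ l₃) h ξ ρ ε)
    (hd : IsDualBasis l₁ l₃ e₁ e₂) (ha : l₂ e₁ ≠ 0)
    (P : Parametrization (lineList ξ l₁ l₂ l₃) (cycle (lineList ξ l₁ l₂ l₃) ξ ρ ε)) :
    (1 / (2 * (Real.pi : ℂ) * Complex.I)) ^ 2 * P.integral h =
      fderiv ℂ h ξ e₁ / (l₂ e₁ * formDet l₁ l₃) := by
  have hf : ∀ j, Differentiable ℂ (lineList ξ l₁ l₂ l₃ j) := differentiable_lineList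
  have hε := hA.eps_pos
  have hΓ : ∀ z ∈ cycle (lineList ξ l₁ l₂ l₃) ξ ρ ε, ∀ j, ‖lineList ξ l₁ l₂ l₃ j z‖ = ε j :=
    fun z hz => hz.2
  obtain ⟨K, hK⟩ := exists_lipschitzOnWith_lineList ξ l₁ l₂ l₃ ρ
  have hK' : ∀ j, LipschitzOnWith K (lineList ξ l₁ l₂ l₃ j)
      (cycle (lineList ξ l₁ l₂ l₃) ξ ρ ε) := fun j =>
    (hK j).mono fun z hz => ball_subset_closedBall hz.1
  have hc := isCompact_cycle hA
  let S := lineSheets hA hd ha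
  let g : EuclideanSpace ℂ (Fin 2) → ℂ := fun z => h z / jacobian (lineList ξ l₁ l₂ l₃) z
  have hgc : ContinuousOn g (cycle (lineList ξ l₁ l₂ l₃) ξ ρ ε) :=
    continuousOn_div_jacobian hA hd fun z hz =>
      (hA.differentiableOn_closedBall z
        (ball_subset_closedBall hz.1)).continuousAt.continuousWithinAt
  have hmem : ∀ c θ, S.chart c θ ∈ cycle (lineList ξ l₁ l₂ l₃) ξ ρ ε := S.chart_mem hε
  have hnorm : ∀ α : ℝ, ‖Complex.exp (α * Complex.I)‖ = 1 := Complex.norm_exp_ofReal_mul_I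
  have hscale : ∀ t : ℂ, Continuous (scale ξ t) := fun t => by unfold scale; fun_prop
  have hgint : ∀ (t : ℂ), ‖t‖ = 1 → ∀ c,
      IntegrableOn (fun θ => g (scale ξ t (S.chart c θ))) (angleBox 2) := fun t ht c =>
    integrable_comp_of_continuousOn hc hgc ((hscale t).measurable.comp (S.measurable_chart c))
      fun θ => scale_mem_cycle hA ht (hmem c θ)
  have hg1 : ∀ c, IntegrableOn (fun θ => g (S.chart c θ)) (angleBox 2) := fun c => by
    simpa [scale] using hgint 1 (by simp) c
  set I := ∑ c, ∫ θ in angleBox 2, g (S.chart c θ) with hI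
  have hPI : P.integral h = Complex.I ^ 2 * I := by
    rw [P.integral_eq hε hΓ hf hA.regular, hI, ← P.sum_integral_eq S hε hΓ hf hK' hg1]
  have hrot : ∀ t : ℂ, ‖t‖ = 1 →
      ∑ c, ∫ θ in angleBox 2, g (scale ξ t (S.chart c θ)) = I := by
    intro t ht
    have ht0 : t ≠ 0 := by rw [← norm_pos_iff, ht]; exact one_pos
    have hcne : ∀ j, (![t ^ 2, t] : Fin 2 → ℂ) j ≠ 0 := by
      intro j
      fin_cases j <;> simp [ht0]
    let P' := P.rotate ξ ht ![t ^ 2, t] hcne (lineList_scale t)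
      (fun z hz => scale_mem_cycle hA ht hz)
      (fun z hz => scale_mem_cycle hA (by rw [norm_inv, ht, inv_one]) hz)
    -- Both sums become integrals over the same parameter domains: of g in the rotated
    -- parametrization, and of the rotated g in the original one. The densities agree because
    -- rotation preserves the forms d(arg fⱼ).
    rw [hI, ← P'.sum_integral_eq S hε hΓ hf hK' hg1,
      ← P.sum_integral_eq (g := fun z => g (scale ξ t z)) S hε hΓ hf hK' (hgint t ht)]
    refine Finset.sum_congr rfl fun k _ => ?_
    refine integral_congr_ae (Filter.Eventually.of_forall fun x => ?_)
    show _ = pullbackDarg _ (fun y => scale ξ t (P.φ k y)) x • _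
    rw [pullbackDarg_scale _ ξ _ hcne (lineList_scale t)]
    rfl
  let D := fderiv ℂ h ξ
  let g' : EuclideanSpace ℂ (Fin 2) → ℂ :=
    fun z => D (z - ξ) / jacobian (lineList ξ l₁ l₂ l₃) z
  have hg'c : ContinuousOn g' (cycle (lineList ξ l₁ l₂ l₃) ξ ρ ε) :=
    continuousOn_div_jacobian hA hd (by fun_prop)
  -- Integrate the invariance over all angles α and exchange the order; the integrand is bounded
  -- because Γ is compact and the Jacobian does not vanish there.
  have havg : 2 * Real.pi * I = 2 * Real.pi * ∑ c, ∫ θ in angleBox 2, g' (S.chart c θ) := by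
    have hfub : ∀ c, Integrable (Function.uncurry fun (α : ℝ) (θ : Fin 2 → ℝ) =>
        g (scale ξ (Complex.exp (α * Complex.I)) (S.chart c θ)))
        ((volume.restrict (Set.uIoc 0 (2 * Real.pi))).prod (volume.restrict (angleBox 2))) := by
      intro c
      have : IsFiniteMeasure (volume.restrict (Set.uIoc 0 (2 * Real.pi))) :=
        ⟨by simp [Set.uIoc]⟩
      refine integrable_comp_of_continuousOn (X := ℝ × (Fin 2 → ℝ)) hc hgc
        (q := fun x => scale ξ (Complex.exp (x.1 * Complex.I)) (S.chart c x.2)) ?_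
        fun x => scale_mem_cycle hA (hnorm _) (hmem c _)
      have hch : Measurable fun x : ℝ × (Fin 2 → ℝ) => S.chart c x.2 :=
        (S.measurable_chart c).comp measurable_snd
      have hex : Measurable fun x : ℝ × (Fin 2 → ℝ) => Complex.exp (x.1 * Complex.I) := by
        fun_prop
      exact measurable_const.add (hex.smul (hch.sub measurable_const))
    calc 2 * Real.pi * I
        = ∫ α in (0 : ℝ)..2 * Real.pi, ∑ c, ∫ θ in angleBox 2,
            g (scale ξ (Complex.exp (α * Complex.I)) (S.chart c θ)) := by
          simp_rw [fun α : ℝ => hrot _ (hnorm α)]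
          simp
      _ = ∑ c, ∫ α in (0 : ℝ)..2 * Real.pi, ∫ θ in angleBox 2,
            g (scale ξ (Complex.exp (α * Complex.I)) (S.chart c θ)) := by
          refine intervalIntegral.integral_finsetSum fun c _ => ?_
          rw [intervalIntegrable_iff]
          exact (hfub c).integral_prod_left
      _ = ∑ c, ∫ θ in angleBox 2, 2 * Real.pi * g' (S.chart c θ) := by
          refine Finset.sum_congr rfl fun c _ => ?_
          rw [intervalIntegral_integral_swap (hfub c)]
          refine integral_congr_ae (Filter.Eventually.of_forall fun θ => ?_)
          exact intervalIntegral_scale_div_jacobian hA hd (hmem c θ).1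
      _ = _ := by
          rw [Finset.mul_sum]
          exact Finset.sum_congr rfl fun c _ => integral_const_mul _ _
  have hpi : (Real.pi : ℂ) ≠ 0 := by exact_mod_cast Real.pi_ne_zero
  -- There are four sign vectors δ, each contributing the volume π² of the angle box.
  have hI' : I = 4 * Real.pi ^ 2 * (D e₁ / (l₂ e₁ * formDet l₁ l₃)) := by
    rw [mul_left_cancel₀ (mul_ne_zero two_ne_zero hpi) havg, Fintype.sum_prod_type_right]
    have hδ := sum_integral_fderiv_div_jacobian hA hd ha D
    rw [Finset.sum_congr rfl fun δ _ => hδ δ]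
    rw [Finset.sum_const, Finset.card_univ]
    simp
    ring
  rw [hPI, hI']
  have := Complex.I_ne_zero
  field_simp
  ring

end

/-! ### Explicit smooth branches and existence of a contour. -/

/-- For `κ` small, `U = quadBranch a b κ t σ θ` solves
`U (a U + b v) = κ t² exp (i θ₀)` with `v = t exp (i θ₁)`. -/
def quadBranch (a b : ℂ) (κ t : ℝ) (σ : ℂ) (θ : Fin 2 → ℝ) : ℂ :=
  b * (t * Complex.exp (Complex.I * θ 1)) / (2 * a) *
    (-1 + σ * Complex.exp (Complex.log (1 + 4 * a * κ / b ^ 2 *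
      Complex.exp (Complex.I * (θ 0 - 2 * θ 1))) / 2))

section Branch

variable {a b : ℂ} {κ t : ℝ}

lemma one_add_mem_slitPlane (hκ : ‖4 * a * κ / b ^ 2‖ < 1) (θ : Fin 2 → ℝ) :
    1 + 4 * a * κ / b ^ 2 * Complex.exp (Complex.I * (θ 0 - 2 * θ 1)) ∈ Complex.slitPlane := by
  apply Complex.mem_slitPlane_of_norm_lt_one
  rw [norm_mul]
  have := Complex.norm_exp_I_mul_ofReal (θ 0 - 2 * θ 1)
  push_cast at this
  rwa [this, mul_one]

lemma contDiff_quadBranch (hκ : ‖4 * a * κ / b ^ 2‖ < 1) (σ : ℂ) :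
    ContDiff ℝ 1 (quadBranch a b κ t σ) := by
  have he : ∀ j, ContDiff ℝ 1 fun θ : Fin 2 → ℝ => ((θ j : ℝ) : ℂ) := fun j =>
    Complex.ofRealCLM.contDiff.comp (contDiff_apply ℝ ℝ j)
  have h1 : ContDiff ℝ 1 fun θ : Fin 2 → ℝ =>
      1 + 4 * a * κ / b ^ 2 * Complex.exp (Complex.I * (θ 0 - 2 * θ 1)) :=
    contDiff_const.add (contDiff_const.mul (contDiff_const.mul
      ((he 0).sub (contDiff_const.mul (he 1)))).cexp)
  have h2 : ContDiff ℝ 1 fun θ : Fin 2 → ℝ => Complex.log (1 + 4 * a * κ / b ^ 2 *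
      Complex.exp (Complex.I * (θ 0 - 2 * θ 1))) :=
    contDiff_iff_contDiffAt.2 fun θ =>
      ContDiffAt.comp (g := Complex.log) θ
        ((Complex.contDiffAt_log (one_add_mem_slitPlane hκ θ)).restrict_scalars ℝ) h1.contDiffAt
  unfold quadBranch
  exact ((contDiff_const.mul (contDiff_const.mul (contDiff_const.mul (he 1)).cexp)).div_const _).mul
    (contDiff_const.add (contDiff_const.mul (h2.div_const 2).cexp))

lemma exp_log_div_two_sq {x : ℂ} (hx : x ≠ 0) : Complex.exp (Complex.log x / 2) ^ 2 = x := by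
  rw [← Complex.exp_nat_mul]
  push_cast
  rw [mul_div_cancel₀ _ two_ne_zero, Complex.exp_log hx]

lemma two_mul_quadBranch (ha : a ≠ 0) (σ : ℂ) (θ : Fin 2 → ℝ) :
    2 * a * quadBranch a b κ t σ θ + b * (t * Complex.exp (Complex.I * θ 1)) =
      σ * (b * (t * Complex.exp (Complex.I * θ 1)) *
        Complex.exp (Complex.log (1 + 4 * a * κ / b ^ 2 *
          Complex.exp (Complex.I * (θ 0 - 2 * θ 1))) / 2)) := by
  rw [quadBranch]
  field_simp
  ring

/-- With v = t exp(iθ₁), factoring (bv)² out of the discriminant leaves 1 plus a term of modulus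
less than 1, which has a smooth square root through the principal logarithm. -/
lemma discriminant_eq (hb : b ≠ 0) (hκ : ‖4 * a * κ / b ^ 2‖ < 1) (θ : Fin 2 → ℝ) :
    (b * (t * Complex.exp (Complex.I * θ 1)) *
        Complex.exp (Complex.log (1 + 4 * a * κ / b ^ 2 *
          Complex.exp (Complex.I * (θ 0 - 2 * θ 1))) / 2)) ^ 2 =
      (b * (t * Complex.exp (Complex.I * θ 1))) ^ 2 +
        4 * a * (κ * t ^ 2 * Complex.exp (Complex.I * θ 0)) := by
  rw [mul_pow, exp_log_div_two_sq (Complex.slitPlane_ne_zero (one_add_mem_slitPlane hκ θ))]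
  have : Complex.exp (Complex.I * θ 0) =
      Complex.exp (Complex.I * (θ 0 - 2 * θ 1)) * Complex.exp (Complex.I * θ 1) ^ 2 := by
    rw [← Complex.exp_nat_mul, ← Complex.exp_add]
    push_cast
    ring_nf
  rw [this]
  field_simp

lemma quadBranch_eq (ha : a ≠ 0) (hb : b ≠ 0) (hκ : ‖4 * a * κ / b ^ 2‖ < 1) {σ : ℂ}
    (hσ : σ ^ 2 = 1) (θ : Fin 2 → ℝ) :
    quadBranch a b κ t σ θ *
      (a * quadBranch a b κ t σ θ + b * (t * Complex.exp (Complex.I * θ 1))) =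
      κ * t ^ 2 * Complex.exp (Complex.I * θ 0) := by
  have h1 := congrArg (· ^ 2) (two_mul_quadBranch (b := b) (κ := κ) (t := t) ha σ θ)
  rw [mul_pow σ, hσ, one_mul, discriminant_eq hb hκ] at h1
  have h5 : (4 * a) ≠ 0 := by simpa using ha
  apply mul_left_cancel₀ h5
  linear_combination h1

lemma eq_quadBranch (ha : a ≠ 0) (hb : b ≠ 0) (hκ : ‖4 * a * κ / b ^ 2‖ < 1) {u : ℂ}
    (θ : Fin 2 → ℝ)
    (hu : u * (a * u + b * (t * Complex.exp (Complex.I * θ 1))) =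
      κ * t ^ 2 * Complex.exp (Complex.I * θ 0)) :
    u = quadBranch a b κ t 1 θ ∨ u = quadBranch a b κ t (-1) θ := by
  have h4 : (2 * a * u + b * (t * Complex.exp (Complex.I * θ 1))) ^ 2 = _ ^ 2 :=
    (show _ = _ by linear_combination 4 * a * hu).trans (discriminant_eq hb hκ θ).symm
  have h5 : (2 * a) ≠ 0 := by simpa using ha
  rcases sq_eq_sq_iff_eq_or_eq_neg.1 h4 with h | h
  · left
    apply mul_left_cancel₀ h5
    linear_combination h - two_mul_quadBranch (b := b) (κ := κ) (t := t) ha 1 θ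
  · right
    apply mul_left_cancel₀ h5
    linear_combination h - two_mul_quadBranch (b := b) (κ := κ) (t := t) ha (-1) θ

lemma quadBranch_injective (ha : a ≠ 0) (hb : b ≠ 0) (ht : t ≠ 0) (θ : Fin 2 → ℝ) {σ σ' : ℂ}
    (h : quadBranch a b κ t σ θ = quadBranch a b κ t σ' θ) : σ = σ' := by
  have h1 := two_mul_quadBranch (b := b) (κ := κ) (t := t) ha σ θ
  rw [h, two_mul_quadBranch ha σ' θ] at h1
  refine (mul_right_cancel₀ ?_ h1).symm
  have ht' : (t : ℂ) ≠ 0 := by exact_mod_cast ht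
  exact mul_ne_zero (mul_ne_zero hb (mul_ne_zero ht' (Complex.exp_ne_zero _))) (Complex.exp_ne_zero _)

end Branch

/-- The parameters are themselves arguments of the fⱼ, so the matrix of the forms d(arg fⱼ) is the
identity. -/
lemma pullbackDarg_of_exp {n : ℕ} {f : Fin n → EuclideanSpace ℂ (Fin n) → ℂ}
    {φ : (Fin n → ℝ) → EuclideanSpace ℂ (Fin n)} {ε : Fin n → ℝ} (hε : ∀ j, ε j ≠ 0)
    (hfφ : ∀ j θ, f j (φ θ) = ε j * Complex.exp (Complex.I * θ j)) (x : Fin n → ℝ) :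
    pullbackDarg f φ x = 1 := by
  rw [pullbackDarg]
  refine Eq.trans (congrArg Matrix.det ?_) (Matrix.det_one (n := Fin n) (R := ℝ))
  ext i j
  have h1 : HasFDerivAt (fun y : Fin n → ℝ => ((y i : ℝ) : ℂ))
      (Complex.ofRealCLM ∘L ContinuousLinearMap.proj i) x :=
    (Complex.ofRealCLM ∘L ContinuousLinearMap.proj (R := ℝ) (φ := fun _ : Fin n => ℝ) i).hasFDerivAt
  have h2 := ((h1.const_mul Complex.I).cexp).const_mul (ε i : ℂ)
  have hεi : (ε i : ℂ) ≠ 0 := by exact_mod_cast hε i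
  simp only [hfφ, Matrix.of_apply]
  rw [h2.fderiv]
  have he := Complex.exp_ne_zero (Complex.I * x i)
  simp only [smul_apply, ContinuousLinearMap.comp_apply, ContinuousLinearMap.proj_apply,
    Complex.ofRealCLM_apply, smul_eq_mul, Matrix.one_apply, Pi.single_apply]
  rw [mul_div_mul_left _ _ hεi, mul_div_cancel_left₀ _ he]
  split_ifs <;> simp

lemma exp_injOn_Ioo {x y : ℝ} (hx : x ∈ Set.Ioo (-Real.pi) Real.pi)
    (hy : y ∈ Set.Ioo (-Real.pi) Real.pi)
    (h : Complex.exp (Complex.I * x) = Complex.exp (Complex.I * y)) : x = y := by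
  have := Complex.exp_inj_of_neg_pi_lt_of_le_pi (x := Complex.I * x) (y := Complex.I * y)
    (by simpa using hx.1) (by simpa using hx.2.le) (by simpa using hy.1) (by simpa using hy.2.le) h
  simpa using this

/-- A C¹ curve has Hausdorff dimension at most 1. This disposes of the seams where an angle equals
π. -/
lemma hausdorffMeasure_two_range_eq_zero {E : Type*} [NormedAddCommGroup E] [NormedSpace ℝ E]
    [MeasurableSpace E] [BorelSpace E] {ψ : ℝ → E} (hψ : ContDiff ℝ 1 ψ) :
    Measure.hausdorffMeasure ((2 : ℕ) : ℝ) (Set.range ψ) = 0 := by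
  have h1 := hψ.dimH_range_le
  rw [Module.finrank_self] at h1
  have := hausdorffMeasure_of_dimH_lt (s := Set.range ψ) (d := 2)
    (h1.trans_lt (by norm_num))
  simpa using this

section

variable {ξ : EuclideanSpace ℂ (Fin 2)} {l₁ l₂ l₃ : EuclideanSpace ℂ (Fin 2) →L[ℂ] ℂ}
  {e₁ e₂ : EuclideanSpace ℂ (Fin 2)} {h : EuclideanSpace ℂ (Fin 2) → ℂ} {ρ : ℝ}

/-- The contour with well separated sheets is parametrized by two graphs over a square. -/
theorem nonempty_parametrization {κ t : ℝ} (hκ : ‖4 * l₂ e₁ * κ / l₂ e₂ ^ 2‖ < 1)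
    (hA : IsAdmissible (lineList ξ l₁ l₂ l₃) h ξ ρ ![κ * t ^ 2, t])
    (hd : IsDualBasis l₁ l₃ e₁ e₂) (ha : l₂ e₁ ≠ 0) (hb : l₂ e₂ ≠ 0) :
    Nonempty (Parametrization (lineList ξ l₁ l₂ l₃)
      (cycle (lineList ξ l₁ l₂ l₃) ξ ρ ![κ * t ^ 2, t])) := by
  have hε := hA.eps_pos
  have ht : 0 < t := hε 1
  let s : Fin 2 → ℂ := ![1, -1]
  have hs : ∀ k, s k ^ 2 = 1 := by
    intro k
    fin_cases k <;> simp [s]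
  have hsinj : ∀ k l, s k = s l → k = l := by
    intro k l h
    fin_cases k <;> fin_cases l
    · rfl
    · norm_num [s] at h
    · norm_num [s] at h
    · rfl
  let φ : Fin 2 → (Fin 2 → ℝ) → EuclideanSpace ℂ (Fin 2) := fun k θ =>
    ξ + (quadBranch (l₂ e₁) (l₂ e₂) κ t (s k) θ • e₁ +
      ((t : ℂ) * Complex.exp (Complex.I * θ 1)) • e₂)
  have hφ : ∀ k, ContDiff ℝ 1 (φ k) := by
    intro k
    have he : ContDiff ℝ 1 fun θ : Fin 2 → ℝ => (t : ℂ) * Complex.exp (Complex.I * θ 1) :=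
      contDiff_const.mul
        (contDiff_const.mul (Complex.ofRealCLM.contDiff.comp (contDiff_apply ℝ ℝ 1))).cexp
    exact contDiff_const.add (((contDiff_quadBranch hκ (s k)).smul contDiff_const).add
      (he.smul contDiff_const))
  have hfφ : ∀ k j θ, lineList ξ l₁ l₂ l₃ j (φ k θ) =
      ((![κ * t ^ 2, t] : Fin 2 → ℝ) j : ℂ) * Complex.exp (Complex.I * θ j) := by
    intro k j θ
    rw [congrFun (lineList_add (ξ := ξ) (l₂ := l₂) hd _ _) j, quadBranch_eq ha hb hκ (hs k)]
    fin_cases j <;> simp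
  have hne : ∀ j, (((![κ * t ^ 2, t] : Fin 2 → ℝ) j : ℝ) : ℂ) ≠ 0 := fun j => by
    exact_mod_cast (hε j).ne'
  let V : Set (Fin 2 → ℝ) := Set.univ.pi fun _ => Set.Ioo (-Real.pi) Real.pi
  have hinj : ∀ k l, ∀ x ∈ V, ∀ y ∈ V, φ k x = φ l y → x = y := by
    intro k l x hx y hy hxy
    ext j
    have h1 := hfφ k j x
    rw [hxy, hfφ l j y] at h1
    exact exp_injOn_Ioo (hx j trivial) (hy j trivial) (mul_left_cancel₀ (hne j) h1).symm
  have hmem : ∀ k θ, φ k θ ∈ cycle (lineList ξ l₁ l₂ l₃) ξ ρ ![κ * t ^ 2, t] := by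
    intro k θ
    rw [mem_cycle_iff hA]
    intro j
    rw [hfφ, norm_mul, Complex.norm_exp_I_mul_ofReal, Complex.norm_real,
      Real.norm_of_nonneg (hε j).le, mul_one]
  refine ⟨{
    N := 2
    V := fun _ => V
    φ := φ
    isOpen := fun _ => isOpen_set_pi Set.finite_univ fun _ _ => isOpen_Ioo
    contDiffOn := fun k => (hφ k).contDiffOn
    injOn := fun k x hx y hy hxy => hinj k k x hx y hy hxy
    mapsTo := fun k θ _ => hmem k θ
    oriented := fun k x _ => by
      rw [pullbackDarg_of_exp (fun j => (hε j).ne') (hfφ k)]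
      exact one_pos
    disjoint := fun k l hkl => by
      refine Set.disjoint_left.2 ?_
      rintro _ ⟨x, hx, rfl⟩ ⟨y, hy, hxy⟩
      have hyx := hinj l k y hy x hx hxy
      subst hyx
      have h1 := congrArg l₁ (add_left_cancel hxy)
      simp only [map_add, map_smul, hd.apply₁₁, hd.apply₁₂, smul_eq_mul, mul_one, mul_zero,
        add_zero] at h1
      exact hkl (hsinj l k (quadBranch_injective ha hb ht.ne' y h1)).symm
    covers := ?_ }⟩
  have hedge : ∀ k (j : Fin 2), ContDiff ℝ 1 fun x : ℝ =>
      φ k (Function.update (fun _ => x) j Real.pi) := by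
    intro k j
    refine (hφ k).comp (contDiff_pi.2 fun i => ?_)
    by_cases hij : i = j
    · subst hij
      simpa using contDiff_const
    · simpa only [Function.update_of_ne hij] using contDiff_fun_id
  refine measure_mono_null (t := ⋃ k : Fin 2, ⋃ j : Fin 2,
    Set.range fun x : ℝ => φ k (Function.update (fun _ => x) j Real.pi)) ?_
    (measure_iUnion_null fun k => measure_iUnion_null fun j =>
      hausdorffMeasure_two_range_eq_zero (hedge k j))
  rintro z ⟨hz, hz'⟩
  let θ : Fin 2 → ℝ := fun j => (lineList ξ l₁ l₂ l₃ j z).arg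
  have hF : ∀ j, lineList ξ l₁ l₂ l₃ j z =
      ((![κ * t ^ 2, t] : Fin 2 → ℝ) j : ℂ) * Complex.exp (Complex.I * θ j) := by
    intro j
    conv_lhs => rw [eq_norm_mul_exp_arg (lineList ξ l₁ l₂ l₃ j z), hz.2 j]
  have h0 : l₁ (z - ξ) * l₂ (z - ξ) = κ * t ^ 2 * Complex.exp (Complex.I * θ 0) := by
    have := hF 0
    simpa [lineList] using this
  have h1 : l₃ (z - ξ) = t * Complex.exp (Complex.I * θ 1) := by
    have := hF 1
    simpa [lineList] using this
  rw [hd.apply_eq (l₂ := l₂) (z - ξ), h1] at h0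
  have hzφ : ∃ k, φ k θ = z := by
    have h2 : ∀ k, l₁ (z - ξ) = quadBranch (l₂ e₁) (l₂ e₂) κ t (s k) θ → φ k θ = z := by
      intro k hk
      simp only [φ]
      rw [← hk, ← h1, ← hd.eq_add (z - ξ), add_sub_cancel]
    rcases eq_quadBranch ha hb hκ θ h0 with h | h
    · exact ⟨0, h2 0 h⟩
    · exact ⟨1, h2 1 h⟩
  obtain ⟨k, hk⟩ := hzφ
  have hnot : θ ∉ V := fun hθ => hz' (Set.mem_iUnion.2 ⟨k, θ, hθ, hk⟩)
  -- Principal arguments lie in (-π, π], so only the value π is missing from the open square.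
  have hpi : ∃ j, θ j = Real.pi := by
    by_contra! hcon
    refine hnot fun j _ => ⟨Complex.neg_pi_lt_arg _, lt_of_le_of_ne (Complex.arg_le_pi _) (hcon j)⟩
  obtain ⟨j, hj⟩ := hpi
  -- In `Fin 2` the index `j + 1` is the one other than `j`, so the curve parameter is the remaining
  -- free angle.
  refine Set.mem_iUnion.2 ⟨k, Set.mem_iUnion.2 ⟨j, θ (j + 1), ?_⟩⟩
  simp only
  rw [← hk]
  congr 1
  ext i
  by_cases hij : i = j
  · subst hij
    rw [Function.update_self, hj]
  · rw [Function.update_of_ne hij]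
    congr 1
    fin_cases i <;> fin_cases j <;> simp_all

/-- Admissible contours for `{l₁ l₂, l₃}` exist. -/
theorem exists_isAdmissible (hd : IsDualBasis l₁ l₃ e₁ e₂) (ha : l₂ e₁ ≠ 0) (hb : l₂ e₂ ≠ 0)
    (hdet : formDet l₁ l₃ ≠ 0) {W : Set (EuclideanSpace ℂ (Fin 2))} (hW : IsOpen W)
    (hξW : ξ ∈ W) (hh : DifferentiableOn ℂ h W) :
    ∃ (ρ κ t : ℝ), ‖4 * l₂ e₁ * κ / l₂ e₂ ^ 2‖ < 1 ∧
      IsAdmissible (lineList ξ l₁ l₂ l₃) h ξ ρ ![κ * t ^ 2, t] := by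
  obtain ⟨ρ, hρ, hρW⟩ := nhds_basis_closedBall.mem_iff.1 (hW.mem_nhds hξW)
  have hzero : ∀ z, (∀ j, lineList ξ l₁ l₂ l₃ j z = 0) ↔ z = ξ := by
    intro z
    constructor
    · intro hz
      have h3 : l₃ (z - ξ) = 0 := hz 1
      have h0 : l₁ (z - ξ) * l₂ (z - ξ) = 0 := hz 0
      rw [hd.apply_eq (l₂ := l₂) (z - ξ), h3, mul_zero, add_zero] at h0
      have h1 : l₁ (z - ξ) = 0 := by
        rcases mul_eq_zero.1 h0 with h | h
        · exact h
        · exact (mul_eq_zero.1 h).resolve_left ha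
      have := hd.eq_add (z - ξ)
      rw [h1, h3, zero_smul, zero_smul, add_zero] at this
      exact sub_eq_zero.1 this
    · rintro rfl j
      fin_cases j <;> simp [lineList]
  -- A positive lower bound on the sphere for the larger of the two moduli; levels below it keep the
  -- contour away from the boundary.
  obtain ⟨m, hm, hmle⟩ := (isCompact_sphere ξ ρ).exists_forall_le' (a := 0)
    (f := fun z => max ‖lineList ξ l₁ l₂ l₃ 0 z‖ ‖lineList ξ l₁ l₂ l₃ 1 z‖)
    (((differentiable_lineList 0).continuous.norm.max
      (differentiable_lineList 1).continuous.norm).continuousOn) (by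
      intro z hz
      by_contra! hcon
      have hz0 : z = ξ := (hzero z).1 fun j => by
        rw [← norm_le_zero_iff]
        fin_cases j
        · exact (le_max_left _ _).trans hcon
        · exact (le_max_right _ _).trans hcon
      rw [hz0, mem_sphere, dist_self] at hz
      exact hρ.ne hz)
  have hna := norm_pos_iff.2 ha
  have hnb := norm_pos_iff.2 hb
  -- With this choice the quantity 4aκ / b² has modulus 1/2.
  set κ : ℝ := ‖l₂ e₂‖ ^ 2 / (8 * ‖l₂ e₁‖) with hκ
  have hκ0 : 0 < κ := by positivity
  -- Since t ≤ 1, both levels t and κt² are at most t(1 + κ) ≤ m/2.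
  set t : ℝ := min 1 (m / (2 * (1 + κ))) with ht
  have ht0 : 0 < t := lt_min one_pos (by positivity)
  have ht1 : t ≤ 1 := min_le_left _ _
  have htm : t * (1 + κ) ≤ m / 2 := by
    have : t ≤ m / (2 * (1 + κ)) := min_le_right _ _
    rw [le_div_iff₀ (by positivity)] at this
    linarith
  have ht2 : t < m := by nlinarith
  have ht3 : κ * t ^ 2 < m := by nlinarith [mul_pos hκ0 ht0]
  refine ⟨ρ, κ, t, ?_, hρ, ?_, ⟨W, hW, hρW, fun j => (differentiable_lineList j).differentiableOn,
    hh⟩, fun z _ => hzero z, ?_, ?_⟩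
  · rw [norm_div, norm_mul, norm_mul, norm_pow, Complex.norm_real, Real.norm_of_nonneg hκ0.le, hκ]
    norm_num
    field_simp
    norm_num
  · intro j
    fin_cases j
    · show 0 < κ * t ^ 2
      positivity
    · exact ht0
  · intro z hz hsm
    refine mem_ball.2 (lt_of_le_of_ne (mem_closedBall.1 hz) fun hzs => ?_)
    have h1 := hmle z hzs
    have h2 : ‖lineList ξ l₁ l₂ l₃ 0 z‖ ≤ κ * t ^ 2 := hsm 0
    have h3 : ‖lineList ξ l₁ l₂ l₃ 1 z‖ ≤ t := hsm 1
    rcases le_max_iff.1 h1 with h | h <;> linarith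
  · rintro z ⟨-, hz⟩ hJ
    rw [jacobian_lineList hd] at hJ
    have h1 := (mul_eq_zero.1 hJ).resolve_right hdet
    have h2 : ‖l₁ (z - ξ) * l₂ (z - ξ)‖ = κ * t ^ 2 := hz 0
    have h3 : ‖l₃ (z - ξ)‖ = t := hz 1
    -- A zero of the Jacobian is a zero of the discriminant, which forces |l₁l₂| = |b|²t² / (4|a|) =
    -- 2κt², not κt².
    have h4 : l₁ (z - ξ) * l₂ (z - ξ) = -(l₂ e₂ ^ 2 * l₃ (z - ξ) ^ 2) / (4 * l₂ e₁) := by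
      rw [hd.apply_eq (l₂ := l₂) (z - ξ)]
      field_simp
      linear_combination (2 * l₂ e₁ * l₁ (z - ξ) + l₂ e₂ * l₃ (z - ξ)) * h1
    rw [h4, norm_div, norm_neg, norm_mul, norm_mul, norm_pow, norm_pow, h3, hκ] at h2
    norm_num at h2
    field_simp at h2
    norm_num at h2

/-- The local residue of `{l₁ l₂, l₃}` at `ξ` is a directional derivative of `h`. -/
theorem hasLocalResidue_lineList (hd : IsDualBasis l₁ l₃ e₁ e₂) (ha : l₂ e₁ ≠ 0)
    (hb : l₂ e₂ ≠ 0) (hdet : formDet l₁ l₃ ≠ 0) {W : Set (EuclideanSpace ℂ (Fin 2))}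
    (hW : IsOpen W) (hξW : ξ ∈ W) (hh : DifferentiableOn ℂ h W) :
    HasLocalResidue (lineList ξ l₁ l₂ l₃) h ξ (fderiv ℂ h ξ e₁ / (l₂ e₁ * formDet l₁ l₃)) := by
  refine ⟨?_, fun ρ ε hA P => integral_lineList hA hd ha P⟩
  obtain ⟨ρ, κ, t, hκ, hA⟩ := exists_isAdmissible hd ha hb hdet hW hξW hh
  exact ⟨ρ, _, hA, nonempty_parametrization hκ hA hd ha hb⟩

end

/-! ### From polynomials of degree at most 1 to linear forms. -/

/-- The linear form `A z₁ + B z₂`. -/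
def linForm (A B : ℂ) : EuclideanSpace ℂ (Fin 2) →L[ℂ] ℂ :=
  A • EuclideanSpace.proj 0 + B • EuclideanSpace.proj 1

lemma linForm_apply (A B : ℂ) (z : EuclideanSpace ℂ (Fin 2)) :
    linForm A B z = A * z 0 + B * z 1 := rfl

lemma linForm_vec (A B x y : ℂ) : linForm A B !₂[x, y] = A * x + B * y := rfl

lemma exists_eq_of_totalDegree_le_one {f : MvPolynomial (Fin 2) ℂ} (hf : f.totalDegree ≤ 1) :
    ∃ c A B : ℂ, f = MvPolynomial.C c + MvPolynomial.C A * MvPolynomial.X 0 +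
      MvPolynomial.C B * MvPolynomial.X 1 := by
  refine ⟨f.coeff 0, f.coeff (Finsupp.single 0 1), f.coeff (Finsupp.single 1 1), ?_⟩
  ext m
  simp only [MvPolynomial.coeff_add, MvPolynomial.coeff_C_mul, MvPolynomial.coeff_C,
    MvPolynomial.coeff_X]
  by_cases h0 : m = 0
  · subst h0
    simp
  by_cases h1 : m = Finsupp.single 0 1
  · subst h1
    simp [Finsupp.single_left_inj, Ne.symm h0]
  by_cases h2 : m = Finsupp.single 1 1
  · subst h2
    simp [Finsupp.single_left_inj, Ne.symm h0]
  rw [if_neg (Ne.symm h0), if_neg (Ne.symm h1), if_neg (Ne.symm h2),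
    MvPolynomial.coeff_eq_zero_of_totalDegree_lt]
  · simp
  · refine hf.trans_lt ?_
    change 1 < m.sum fun _ e => e
    rw [Finsupp.sum_fintype _ _ fun _ => rfl, Fin.sum_univ_two]
    by_contra! hle
    have hm : m 0 = 0 ∧ m 1 = 0 ∨ m 0 = 1 ∧ m 1 = 0 ∨ m 0 = 0 ∧ m 1 = 1 := by omega
    rcases hm with h | h | h
    · exact h0 (Finsupp.ext fun i => by fin_cases i <;> simp [h])
    · exact h1 (Finsupp.ext fun i => by fin_cases i <;> simp [h])
    · exact h2 (Finsupp.ext fun i => by fin_cases i <;> simp [h])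

lemma exists_ne_zero_of_det_eq_zero {A₁ B₁ A₂ B₂ : ℂ} (hdet : A₁ * B₂ - B₁ * A₂ = 0) :
    ∃ v : Fin 2 → ℂ, v ≠ 0 ∧ A₁ * v 0 + B₁ * v 1 = 0 ∧ A₂ * v 0 + B₂ * v 1 = 0 := by
  obtain ⟨v, hv, hv0⟩ := Matrix.exists_mulVec_eq_zero_iff.2
    (show (!![A₁, B₁; A₂, B₂]).det = 0 by rw [Matrix.det_fin_two_of, hdet])
  refine ⟨v, hv, ?_, ?_⟩
  · simpa [Matrix.mulVec, dotProduct, Fin.sum_univ_two] using congrFun hv0 0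
  · simpa [Matrix.mulVec, dotProduct, Fin.sum_univ_two] using congrFun hv0 1

/-- An ideal of polynomials vanishing on a line is not zero-dimensional. -/
lemma ringKrullDim_quotient_ne_zero_of_line {σ : Type*} {I : Ideal (MvPolynomial σ ℂ)}
    (p v : σ → ℂ) (hv : v ≠ 0)
    (hI : ∀ f ∈ I, MvPolynomial.aeval
      (fun i => Polynomial.C (p i) + Polynomial.C (v i) * Polynomial.X) f = 0) :
    ringKrullDim (MvPolynomial σ ℂ ⧸ I) ≠ 0 := by
  intro hdim
  let Φ : MvPolynomial σ ℂ →ₐ[ℂ] Polynomial ℂ :=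
    MvPolynomial.aeval (fun i => Polynomial.C (p i) + Polynomial.C (v i) * Polynomial.X)
  obtain ⟨i, hi⟩ := Function.ne_iff.1 hv
  -- On a line with vᵢ ≠ 0 the parameter is recovered as (zᵢ - pᵢ) / vᵢ. The quotient therefore
  -- surjects onto ℂ[X], which has dimension 1.
  have hsurj : Function.Surjective Φ := by
    let Ψ : Polynomial ℂ →ₐ[ℂ] MvPolynomial σ ℂ := Polynomial.aeval
      (MvPolynomial.C (v i)⁻¹ * (MvPolynomial.X i - MvPolynomial.C (p i)))
    have hΦΨ : Φ.comp Ψ = AlgHom.id ℂ _ := by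
      refine Polynomial.algHom_ext ?_
      have hC : Polynomial.C (v i)⁻¹ * Polynomial.C (v i) = (1 : Polynomial ℂ) := by
        rw [← Polynomial.C_mul, inv_mul_cancel₀ hi, Polynomial.C_1]
      simp only [AlgHom.comp_apply, Ψ, Φ, Polynomial.aeval_X, map_mul, map_sub,
        MvPolynomial.aeval_X, MvPolynomial.algHom_C, AlgHom.id_apply, Polynomial.algebraMap_eq]
      linear_combination Polynomial.X * hC
    exact fun q => ⟨Ψ q, DFunLike.congr_fun hΦΨ q⟩
  have h1 := ringKrullDim_le_of_surjective (Ideal.Quotient.lift I Φ.toRingHom hI)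
    (Ideal.Quotient.lift_surjective_of_surjective I hI hsurj)
  rw [hdim, Polynomial.ringKrullDim_of_isNoetherianRing, ringKrullDim_eq_zero_of_field,
    zero_add] at h1
  exact absurd h1 (by norm_num)

/-- If the linear parts were dependent, both polynomials would vanish on a common line through ξ, in
the direction of a common kernel vector. -/
lemma det_ne_zero_of_ringKrullDim_eq_zero {ξ : EuclideanSpace ℂ (Fin 2)}
    {c₁ A₁ B₁ c₂ A₂ B₂ : ℂ} {f₁ f₂ : MvPolynomial (Fin 2) ℂ}
    (h₁ : f₁ = MvPolynomial.C c₁ + MvPolynomial.C A₁ * MvPolynomial.X 0 +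
      MvPolynomial.C B₁ * MvPolynomial.X 1)
    (h₂ : f₂ = MvPolynomial.C c₂ + MvPolynomial.C A₂ * MvPolynomial.X 0 +
      MvPolynomial.C B₂ * MvPolynomial.X 1)
    (hξ₁ : polyFun f₁ ξ = 0) (hξ₂ : polyFun f₂ ξ = 0)
    (hdim : ringKrullDim (MvPolynomial (Fin 2) ℂ ⧸ Ideal.span {f₁, f₂}) = 0) :
    A₁ * B₂ - B₁ * A₂ ≠ 0 := by
  intro hdet
  obtain ⟨v, hv, hv₁, hv₂⟩ := exists_ne_zero_of_det_eq_zero hdet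
  have key : ∀ {c A B : ℂ} {f : MvPolynomial (Fin 2) ℂ},
      f = MvPolynomial.C c + MvPolynomial.C A * MvPolynomial.X 0 +
        MvPolynomial.C B * MvPolynomial.X 1 → polyFun f ξ = 0 → A * v 0 + B * v 1 = 0 →
      MvPolynomial.aeval
        (fun i => Polynomial.C (ξ i) + Polynomial.C (v i) * Polynomial.X) f = 0 := by
    rintro c A B f rfl hξ hvf
    simp only [polyFun, map_add, map_mul, MvPolynomial.eval_C, MvPolynomial.eval_X] at hξ
    have h1 := congrArg Polynomial.C hξ
    have h2 := congrArg Polynomial.C hvf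
    simp only [map_add, map_mul, map_zero] at h1 h2
    simp only [map_add, map_mul, MvPolynomial.algHom_C, MvPolynomial.aeval_X,
      Polynomial.algebraMap_eq]
    linear_combination h1 + Polynomial.X * h2
  refine ringKrullDim_quotient_ne_zero_of_line (fun i => ξ i) v hv (fun f hf => ?_) hdim
  have hle : Ideal.span {f₁, f₂} ≤ RingHom.ker (MvPolynomial.aeval (R := ℂ)
      (fun i => Polynomial.C (ξ i) + Polynomial.C (v i) * Polynomial.X)) := by
    rw [Ideal.span_le]
    rintro g (rfl | rfl)
    · exact key h₁ hξ₁ hv₁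
    · exact key h₂ hξ₂ hv₂
  exact hle hf

lemma polyFun_eq_linForm {ξ : EuclideanSpace ℂ (Fin 2)} {c A B : ℂ}
    {f : MvPolynomial (Fin 2) ℂ}
    (h : f = MvPolynomial.C c + MvPolynomial.C A * MvPolynomial.X 0 +
      MvPolynomial.C B * MvPolynomial.X 1)
    (hξ : polyFun f ξ = 0) (z : EuclideanSpace ℂ (Fin 2)) :
    polyFun f z = linForm A B (z - ξ) := by
  subst h
  simp only [polyFun, map_add, map_mul, MvPolynomial.eval_C, MvPolynomial.eval_X] at hξ ⊢
  rw [linForm_apply, PiLp.sub_apply, PiLp.sub_apply]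
  linear_combination hξ

lemma polyFun_list_eq_lineList {ξ : EuclideanSpace ℂ (Fin 2)}
    {l₁ l₂ l₃ : EuclideanSpace ℂ (Fin 2) →L[ℂ] ℂ} {f₁ f₂ f₃ : MvPolynomial (Fin 2) ℂ}
    (h₁ : ∀ z, polyFun f₁ z = l₁ (z - ξ)) (h₂ : ∀ z, polyFun f₂ z = l₂ (z - ξ))
    (h₃ : ∀ z, polyFun f₃ z = l₃ (z - ξ)) :
    ![polyFun (f₁ * f₂), polyFun f₃] = lineList ξ l₁ l₂ l₃ := by
  have h12 : polyFun (f₁ * f₂) = fun z => l₁ (z - ξ) * l₂ (z - ξ) := by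
    ext z
    rw [← h₁, ← h₂, polyFun, map_mul]
    rfl
  rw [h12, show polyFun f₃ = fun z => l₃ (z - ξ) from funext h₃, lineList]

lemma formDet_linForm (A B A' B' : ℂ) :
    formDet (linForm A B) (linForm A' B') = A * B' - B * A' := by
  simp [formDet, linForm_apply]

lemma isDualBasis_linForm {A B A' B' : ℂ} (hdet : A * B' - B * A' ≠ 0) :
    IsDualBasis (linForm A B) (linForm A' B')
      ((A * B' - B * A')⁻¹ • !₂[B', -A']) ((A * B' - B * A')⁻¹ • !₂[-B, A]) where
  apply₁₁ := by rw [map_smul, linForm_vec, smul_eq_mul]; field_simp; ring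
  apply₁₂ := by rw [map_smul, linForm_vec, smul_eq_mul]; ring
  apply₃₁ := by rw [map_smul, linForm_vec, smul_eq_mul]; ring
  apply₃₂ := by rw [map_smul, linForm_vec, smul_eq_mul]; field_simp; ring
  eq_add w := by
    ext i
    fin_cases i <;> simp [linForm_apply] <;> field_simp <;> ring

/-- The local residue of `{l₁ l₂, l₃}` in terms of the coefficients of the linear forms. -/
theorem hasLocalResidue_linForm {ξ : EuclideanSpace ℂ (Fin 2)}
    {A₁ B₁ A₂ B₂ A₃ B₃ : ℂ} (h₁₂ : A₁ * B₂ - B₁ * A₂ ≠ 0) (h₂₃ : A₂ * B₃ - B₂ * A₃ ≠ 0)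
    (h₁₃ : A₁ * B₃ - B₁ * A₃ ≠ 0) {h : EuclideanSpace ℂ (Fin 2) → ℂ}
    {W : Set (EuclideanSpace ℂ (Fin 2))} (hW : IsOpen W) (hξW : ξ ∈ W)
    (hh : DifferentiableOn ℂ h W) :
    HasLocalResidue (lineList ξ (linForm A₁ B₁) (linForm A₂ B₂) (linForm A₃ B₃)) h ξ
      (fderiv ℂ h ξ !₂[B₃, -A₃] / ((A₁ * B₃ - B₁ * A₃) * (A₂ * B₃ - B₂ * A₃))) := by
  have ha : linForm A₂ B₂ ((A₁ * B₃ - B₁ * A₃)⁻¹ • !₂[B₃, -A₃]) =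
      (A₁ * B₃ - B₁ * A₃)⁻¹ * (A₂ * B₃ - B₂ * A₃) := by
    rw [map_smul, linForm_vec, smul_eq_mul]
    ring
  have hb : linForm A₂ B₂ ((A₁ * B₃ - B₁ * A₃)⁻¹ • !₂[-B₁, A₁]) =
      (A₁ * B₃ - B₁ * A₃)⁻¹ * (A₁ * B₂ - B₁ * A₂) := by
    rw [map_smul, linForm_vec, smul_eq_mul]
    ring
  have := hasLocalResidue_lineList (l₂ := linForm A₂ B₂) (isDualBasis_linForm h₁₃)
    (by rw [ha]; exact mul_ne_zero (inv_ne_zero h₁₃) h₂₃)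
    (by rw [hb]; exact mul_ne_zero (inv_ne_zero h₁₃) h₁₂)
    (by rwa [formDet_linForm]) hW hξW hh
  convert this using 1
  rw [ha, formDet_linForm, map_smul, smul_eq_mul]
  field_simp

end LocalResidue

end

/-! ### The sum of the three residues. -/

theorem lemma1 (f₁ f₂ f₃ : MvPolynomial (Fin 2) ℂ) (ξ : EuclideanSpace ℂ (Fin 2))
    (hdeg₁ : f₁.totalDegree ≤ 1) (hdeg₂ : f₂.totalDegree ≤ 1) (hdeg₃ : f₃.totalDegree ≤ 1)
    (hξ₁ : LocalResidue.polyFun f₁ ξ = 0) (hξ₂ : LocalResidue.polyFun f₂ ξ = 0)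
    (hξ₃ : LocalResidue.polyFun f₃ ξ = 0)
    (hdim₁₂ : ringKrullDim (MvPolynomial (Fin 2) ℂ ⧸ Ideal.span {f₁, f₂}) = 0)
    (hdim₂₃ : ringKrullDim (MvPolynomial (Fin 2) ℂ ⧸ Ideal.span {f₂, f₃}) = 0)
    (hdim₃₁ : ringKrullDim (MvPolynomial (Fin 2) ℂ ⧸ Ideal.span {f₃, f₁}) = 0)
    (h : EuclideanSpace ℂ (Fin 2) → ℂ) (W : Set (EuclideanSpace ℂ (Fin 2)))
    (hW : IsOpen W) (hξW : ξ ∈ W) (hh : DifferentiableOn ℂ h W) :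
    ∃ r₁ r₂ r₃ : ℂ,
      LocalResidue.HasLocalResidue
        ![LocalResidue.polyFun (f₁ * f₂), LocalResidue.polyFun f₃] h ξ r₁ ∧
      LocalResidue.HasLocalResidue
        ![LocalResidue.polyFun (f₂ * f₃), LocalResidue.polyFun f₁] h ξ r₂ ∧
      LocalResidue.HasLocalResidue
        ![LocalResidue.polyFun (f₃ * f₁), LocalResidue.polyFun f₂] h ξ r₃ ∧
      r₁ + r₂ + r₃ = 0 := by
  obtain ⟨c₁, A₁, B₁, e₁⟩ := LocalResidue.exists_eq_of_totalDegree_le_one hdeg₁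
  obtain ⟨c₂, A₂, B₂, e₂⟩ := LocalResidue.exists_eq_of_totalDegree_le_one hdeg₂
  obtain ⟨c₃, A₃, B₃, e₃⟩ := LocalResidue.exists_eq_of_totalDegree_le_one hdeg₃
  have h₁₂ := LocalResidue.det_ne_zero_of_ringKrullDim_eq_zero e₁ e₂ hξ₁ hξ₂ hdim₁₂
  have h₂₃ := LocalResidue.det_ne_zero_of_ringKrullDim_eq_zero e₂ e₃ hξ₂ hξ₃ hdim₂₃
  have h₃₁ := LocalResidue.det_ne_zero_of_ringKrullDim_eq_zero e₃ e₁ hξ₃ hξ₁ hdim₃₁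
  have hneg : ∀ {A B A' B' : ℂ}, A * B' - B * A' ≠ 0 → A' * B - B' * A ≠ 0 := fun h0 h1 =>
    h0 (by linear_combination -h1)
  have p₁ := LocalResidue.polyFun_eq_linForm e₁ hξ₁
  have p₂ := LocalResidue.polyFun_eq_linForm e₂ hξ₂
  have p₃ := LocalResidue.polyFun_eq_linForm e₃ hξ₃
  rw [LocalResidue.polyFun_list_eq_lineList p₁ p₂ p₃,
    LocalResidue.polyFun_list_eq_lineList p₂ p₃ p₁, LocalResidue.polyFun_list_eq_lineList p₃ p₁ p₂]
  refine ⟨_, _, _, LocalResidue.hasLocalResidue_linForm h₁₂ h₂₃ (hneg h₃₁) hW hξW hh,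
    LocalResidue.hasLocalResidue_linForm h₂₃ h₃₁ (hneg h₁₂) hW hξW hh,
    LocalResidue.hasLocalResidue_linForm h₃₁ h₁₂ (hneg h₂₃) hW hξW hh, ?_⟩
  -- Expanding the derivative in the two coordinate directions reduces the claim to an identity of
  -- rational functions.
  have hD : ∀ A B : ℂ, fderiv ℂ h ξ !₂[B, -A] =
      B * fderiv ℂ h ξ !₂[1, 0] - A * fderiv ℂ h ξ !₂[0, 1] := by
    intro A B
    rw [← smul_eq_mul, ← smul_eq_mul, ← map_smul, ← map_smul, ← map_sub]
    congr 1
    ext i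
    fin_cases i <;> simp
  rw [hD, hD, hD]
  rw [show A₂ * B₁ - B₂ * A₁ = -(A₁ * B₂ - B₁ * A₂) by ring,
    show A₃ * B₂ - B₃ * A₂ = -(A₂ * B₃ - B₂ * A₃) by ring,
    show A₁ * B₃ - B₁ * A₃ = -(A₃ * B₁ - B₃ * A₁) by ring]
  -- The minors are kept as opaque nonzero symbols while denominators are cleared, then unfolded so
  -- that Cramer's identity becomes a polynomial identity.
  obtain ⟨d₁₂, hd₁₂⟩ : ∃ d, A₁ * B₂ - B₁ * A₂ = d := ⟨_, rfl⟩
  obtain ⟨d₂₃, hd₂₃⟩ : ∃ d, A₂ * B₃ - B₂ * A₃ = d := ⟨_, rfl⟩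
  obtain ⟨d₃₁, hd₃₁⟩ : ∃ d, A₃ * B₁ - B₃ * A₁ = d := ⟨_, rfl⟩
  rw [hd₁₂] at h₁₂ ⊢
  rw [hd₂₃] at h₂₃ ⊢
  rw [hd₃₁] at h₃₁ ⊢
  field_simp
  rw [← hd₁₂, ← hd₂₃, ← hd₃₁]
  ring
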